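/- **SLOCC picture of two qubits.** Every Hermitian operator $W$ on $\mathbb C^2\otimes\mathbb C^2$ is written $W=\sum_{\mu,\nu=0}^3\omega_{\mu\nu}\,\sigma^\mu\otimes\sigma^\nu$ with a real $4\times4$ matrix $\omega$, where $\sigma^0=1$ and $\sigma^1,\sigma^2,\sigma^3$ are the Pauli matrices. A (not normalized) state is a positive semidefinite operator; a separable state is a finite sum of products $\rho_A\otimes\rho_B$ of positive semidefinite one-qubit operators; a potential entanglement witness is a Hermitian $W$ with $\mathrm{Tr}(W\rho)\ge0$ for all separable $\rho$, and it is strict if $\mathrm{Tr}(W\rho)>0$ for all separable $\rho\ne0$. For $M=A\otimes B$ with $A,B\in SL(2,\mathbb C)$, SLOCC acts on states by $\rho\mapsto M\rho M^\dagger$ and on observables by $W\mapsto (M^\dagger)^{-1}WM^{-1}$; two operators are called equivalent if they are related by such an action up to a positive factor. Let $\eta=\mathrm{diag}(1,-1,-1,-1)$ and $\omega^\star=\eta\omega^T\eta$. Lorentz singular values of $W$ are real numbers $\omega_0\ge\omega_1\ge\omega_2\ge|\omega_3|$ whose squares are the eigenvalues of $\omega^\star\omega$ (with algebraic multiplicity),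 with $\mathrm{sign}(\omega_3)=\mathrm{sign}(\det\omega)$. Let $G$ be the group of maps of $\mathbb R^3$ that permute the coordinates and flip an even number of signs. If $\omega_0\neq0$, the points representing $W$ are the elements of the $G$-orbit of $(\omega_1,\omega_2,\omega_3)/\omega_0$; if $\omega_0=0$, there are none. Write $D(d)=\sum_\alpha d_\alpha\,\sigma^\alpha\otimes\sigma^\alpha$ for $d\in\mathbb R^4$, and $D(1,u)$ for $u\in\mathbb R^3$ when $d=(1,u_1,u_2,u_3)$. Let $C=[-1,1]^3$, $$T=\{x\in\mathbb R^3: 1+\epsilon_1x_1+\epsilon_2x_2-\epsilon_1\epsilon_2x_3\ge0\ \ \forall\,\epsilon_1,\epsilon_2=\pm1\},\qquad O=\mathrm{conv}\{\pm e_1,\pm e_2,\pm e_3\},$$ and let $S^\circ=\{y: 0\le 1+x\cdot y\ \ \forall x\in S\}$ denote the polar of $S\subset\mathbb R^3$. Then: 1. Separable states are states, and states are potential witnesses. The SLOCC action on states preserves separable states and states, and the action on observables preserves potential witnesses. Both actions define the same equivalence relation. 2. Every potential witness has uniquely determined Lorentz singular values, and equivalent potential witnesses are represented by the same points. The group $G$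 has 24 elements and each of them maps $T$ onto itself. 3. $D(d)$ has the eigenvalues $d_0+\epsilon_1d_1+\epsilon_2d_2-\epsilon_1\epsilon_2d_3$, $\epsilon_1,\epsilon_2=\pm1$. For $u\in\mathbb R^3$, $D(1,u)$ is a potential witness iff $u\in C$, a state iff $u\in T$, and a separable state iff $u\in O$. For $u,u'\in C$, $D(1,u)$ is represented by the orbit $Gu$, and $D(1,u)$ and $D(1,u')$ are equivalent iff $u'\in Gu$. 4. Every strict witness is equivalent to $D(1,u)$ for some $u\in(-1,1)^3$. Two strict witnesses are equivalent iff they are represented by the same points. A strict witness is a state iff its points lie in $T$, and separable iff its points lie in $O$. The points representing strict witnesses form $(-1,1)^3$. Strictness cannot be dropped: there are inequivalent potential witnesses represented by the same (nonempty) set of points. 5. The set of all points that represent potential witnesses is the cube $C$; the set of all points that represent states is the tetrahedron $T$, which is the convex hull of $(1,1,-1),(1,-1,1),(-1,1,1),(-1,-1,-1)$; and the set of all points that represent separable states is the octahedron $O$. 6. If $\vec\omega$ represents a potential witness and $\vec\rho$ represents a separable state, then $0\le1+\vec\omega\cdot\vec\rho$. Moreover $O=C^\circ$, $C=O^\circ$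 and $T=T^\circ$. -/

import Mathlib

open scoped Kronecker Matrix ComplexOrder

namespace TwoQubit

noncomputable section

/-- One-qubit operators. -/
abbrev Op1 := Matrix (Fin 2) (Fin 2) ℂ

/-- Two-qubit operators, on the tensor product of Alice's and Bob's qubits. -/
abbrev Op2 := Matrix (Fin 2 × Fin 2) (Fin 2 × Fin 2) ℂ

/-- `σ⁰ = 1` and the three Pauli matrices `σ¹, σ², σ³`. -/
def pauli : Fin 4 → Op1 :=
  ![1, !![0, 1; 1, 0], !![0, -Complex.I; Complex.I, 0], !![1, 0; 0, -1]]

/-- The real `4 × 4` matrix `ω` of coefficients of `W = ∑ ω_{μν} σ^μ ⊗ σ^ν`, read off with the trace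
inner product. -/
def coeff (W : Op2) : Matrix (Fin 4) (Fin 4) ℝ :=
  fun μ ν => (Matrix.trace (W * (pauli μ ⊗ₖ pauli ν))).re / 4

theorem pauli_hermitian (μ : Fin 4) : (pauli μ)ᴴ = pauli μ := by
  fin_cases μ <;> ext i j <;> fin_cases i <;> fin_cases j <;> simp [pauli]

/-- Every Hermitian two-qubit operator is `∑ ω_{μν} σ^μ ⊗ σ^ν` with `ω = coeff W`. -/
theorem pauli_expansion (W : Op2) (hW : W.IsHermitian) :
    W = ∑ μ, ∑ ν, ((coeff W μ ν : ℝ) : ℂ) • (pauli μ ⊗ₖ pauli ν) := by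
  have hc : ∀ μ ν, ((coeff W μ ν : ℝ) : ℂ) = Matrix.trace (W * (pauli μ ⊗ₖ pauli ν)) / 4 := by
    intro μ ν
    have h : (starRingEnd ℂ) (Matrix.trace (W * (pauli μ ⊗ₖ pauli ν)))
        = Matrix.trace (W * (pauli μ ⊗ₖ pauli ν)) := by
      rw [starRingEnd_apply, ← Matrix.trace_conjTranspose, Matrix.conjTranspose_mul, hW.eq,
        Matrix.conjTranspose_kronecker, pauli_hermitian, pauli_hermitian, Matrix.trace_mul_comm]
    have h2 := Complex.conj_eq_iff_re.mp h
    simp only [coeff]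
    push_cast
    rw [h2]
  simp only [hc]
  ext ⟨i, j⟩ ⟨k, l⟩
  simp only [Matrix.sum_apply, Matrix.kroneckerMap_apply, Matrix.trace,
    Matrix.diag, Matrix.mul_apply, Fintype.sum_prod_type, Fin.sum_univ_four, Fin.sum_univ_two]
  fin_cases i <;> fin_cases j <;> fin_cases k <;> fin_cases l <;> simp [pauli] <;>
    ring_nf <;> simp only [Complex.I_sq] <;> ring

/-- A state is a positive semidefinite operator; normalization is not imposed. -/
def IsState (ρ : Op2) : Prop := ρ.PosSemidef

/-- A (not normalized) separable state: a finite sum of product states `ρ_A ⊗ ρ_B`. -/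
def IsSeparable (ρ : Op2) : Prop :=
  ∃ (n : ℕ) (a b : Fin n → Op1), (∀ i, (a i).PosSemidef) ∧ (∀ i, (b i).PosSemidef) ∧
    ρ = ∑ i, a i ⊗ₖ b i

/-- Potential entanglement witness: an observable with `Tr (W ρ) ≥ 0` for all separable `ρ`. -/
def IsPotentialWitness (W : Op2) : Prop :=
  W.IsHermitian ∧ ∀ ρ, IsSeparable ρ → 0 ≤ (Matrix.trace (W * ρ)).re

/-- Strict potential witness: the inequality is strict for all nonzero separable `ρ`. -/
def IsStrictWitness (W : Op2) : Prop :=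
  W.IsHermitian ∧ ∀ ρ, IsSeparable ρ → ρ ≠ 0 → 0 < (Matrix.trace (W * ρ)).re

/-- The local operation `M = A ⊗ B`, with `A, B ∈ SL(2, ℂ)`. -/
def localOp (A B : Matrix.SpecialLinearGroup (Fin 2) ℂ) : Op2 :=
  (A : Op1) ⊗ₖ (B : Op1)

/-- SLOCC action on states, `ρ ↦ M ρ M†`. -/
def stateAction (A B : Matrix.SpecialLinearGroup (Fin 2) ℂ) (ρ : Op2) : Op2 :=
  localOp A B * ρ * (localOp A B)ᴴ

/-- Contragredient SLOCC action on observables, `W ↦ (M†)⁻¹ W M⁻¹`. -/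
def witnessAction (A B : Matrix.SpecialLinearGroup (Fin 2) ℂ) (W : Op2) : Op2 :=
  ((localOp A B)ᴴ)⁻¹ * W * (localOp A B)⁻¹

/-- SLOCC equivalence of states, up to a positive scalar. -/
def StateEquiv (ρ ρ' : Op2) : Prop :=
  ∃ r : ℝ, 0 < r ∧ ∃ A B, ρ' = (r : ℂ) • stateAction A B ρ

/-- SLOCC equivalence of witnesses, up to a positive scalar. -/
def WitnessEquiv (W W' : Op2) : Prop :=
  ∃ r : ℝ, 0 < r ∧ ∃ A B, W' = (r : ℂ) • witnessAction A B W

/-- The Minkowski metric `diag(1, -1, -1, -1)`. -/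
def minkowski : Matrix (Fin 4) (Fin 4) ℝ := Matrix.diagonal ![1, -1, -1, -1]

/-- The Minkowski adjoint `ω⋆ = η ωᵀ η`. -/
def minkowskiAdjoint (ω : Matrix (Fin 4) (Fin 4) ℝ) : Matrix (Fin 4) (Fin 4) ℝ :=
  minkowski * ωᵀ * minkowski

/-- `s = (s₀, s₁, s₂, s₃)` are the ordered Lorentz singular values of `W`: their squares are the
eigenvalues of `ω⋆ω`, with algebraic multiplicity, `s₀ ≥ s₁ ≥ s₂ ≥ |s₃|`, and `s₃` has the sign
of `det ω`. -/
def IsLorentzSingularValues (W : Op2) (s : Fin 4 → ℝ) : Prop :=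
  (minkowskiAdjoint (coeff W) * coeff W).charpoly =
      ∏ α, (Polynomial.X - Polynomial.C (s α ^ 2)) ∧
    s 1 ≤ s 0 ∧ s 2 ≤ s 1 ∧ |s 3| ≤ s 2 ∧
    SignType.sign (s 3) = SignType.sign (coeff W).det

/-- The normalized vector `(s₁, s₂, s₃) / s₀`. -/
def normalizedVector (s : Fin 4 → ℝ) : Fin 3 → ℝ := fun i => s i.succ / s 0

/-- The group of coordinate permutations combined with an even number of sign flips. -/
def tetrahedralGroup : Subgroup ((Fin 3 → ℝ) ≃ₗ[ℝ] (Fin 3 → ℝ)) where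
  carrier := {g | ∃ (π : Equiv.Perm (Fin 3)) (ε : Fin 3 → ℤˣ), ∏ i, ε i = 1 ∧
    ∀ v i, g v i = ((ε i : ℤ) : ℝ) * v (π i)}
  one_mem' := ⟨1, fun _ => 1, by simp, by simp⟩
  mul_mem' := by
    rintro g h ⟨π, ε, hε, hg⟩ ⟨π', ε', hε', hh⟩
    refine ⟨π' * π, fun i => ε i * ε' (π i), ?_, fun v i => ?_⟩
    · rw [Finset.prod_mul_distrib, hε, Equiv.prod_comp π ε', hε', one_mul]
    · simp only [LinearEquiv.mul_apply, hg, hh, Equiv.Perm.mul_apply]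
      push_cast
      ring
  inv_mem' := by
    rintro g ⟨π, ε, hε, hg⟩
    refine ⟨π⁻¹, fun i => ε (π⁻¹ i), ?_, fun v i => ?_⟩
    · rw [Equiv.prod_comp π⁻¹ ε, hε]
    · have h := hg (g⁻¹ v) (π⁻¹ i)
      have h1 : g (g⁻¹ v) = v := g.apply_symm_apply v
      rw [h1, show π (π⁻¹ i) = i from π.apply_symm_apply i] at h
      change (g⁻¹ v) i = ((ε (π⁻¹ i) : ℤ) : ℝ) * v (π⁻¹ i)
      rw [h, ← mul_assoc]
      rcases Int.units_eq_one_or (ε (π⁻¹ i)) with h2 | h2 <;> rw [h2] <;> norm_num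

/-- The points of `ℝ³` that represent the SLOCC class of `W`: all images of the normalized vector
of Lorentz singular values under the tetrahedral group. There are none if `s₀ = 0`. -/
def sloccPoints (W : Op2) : Set (Fin 3 → ℝ) :=
  {v | ∃ s, IsLorentzSingularValues W s ∧ s 0 ≠ 0 ∧
    v ∈ MulAction.orbit tetrahedralGroup (normalizedVector s)}

/-- The operator `∑ d_α σ^α ⊗ σ^α`. -/
def canonicalForm (d : Fin 4 → ℝ) : Op2 :=
  ∑ α, ((d α : ℝ) : ℂ) • (pauli α ⊗ₖ pauli α)

/-- The normalized canonical form `1 + ∑ uᵢ σⁱ ⊗ σⁱ`. -/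
def normalForm (u : Fin 3 → ℝ) : Op2 := canonicalForm (Matrix.vecCons 1 u)

/-- The unit cube `[-1, 1]³`. -/
def cube : Set (Fin 3 → ℝ) := {x | ∀ i, |x i| ≤ 1}

/-- The open cube `(-1, 1)³`. -/
def openCube : Set (Fin 3 → ℝ) := {x | ∀ i, |x i| < 1}

/-- The set cut out by the four inequalities `1 + ε₁ x₁ + ε₂ x₂ - ε₁ ε₂ x₃ ≥ 0`, `ε₁, ε₂ = ±1`. -/
def tetrahedron : Set (Fin 3 → ℝ) :=
  {x | ∀ ε₁ ε₂ : ℤˣ, 0 ≤ 1 + ((ε₁ : ℤ) : ℝ) * x 0 + ((ε₂ : ℤ) : ℝ) * x 1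
    - ((ε₁ : ℤ) : ℝ) * ((ε₂ : ℤ) : ℝ) * x 2}

/-- The octahedron with vertices `± eᵢ`. -/
def octahedron : Set (Fin 3 → ℝ) :=
  convexHull ℝ {x | ∃ i : Fin 3, x = Pi.single i 1 ∨ x = -Pi.single i 1}

/-- The polar of a set, in the sign convention `0 ≤ 1 + x ⬝ y`. -/
def polar (S : Set (Fin 3 → ℝ)) : Set (Fin 3 → ℝ) := {y | ∀ x ∈ S, 0 ≤ 1 + x ⬝ᵥ y}

end

end TwoQubit

namespace TwoQubit

noncomputable section

/-! ### One-qubit operators and the light cone -/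

/-! In Pauli coordinates positive semidefinite one-qubit operators form the forward light cone, and
a potential witness is a real matrix ω with x·ωy ≥ 0 for all x, y in that cone
(`isPotentialWitness_iff`). A local operation with scalar r > 0 turns ω into r Lᵀ ω L', where L and
L' are Lorentz matrices of determinant 1 (`coeff_conjLocal`, `lorentz_transpose_mul`,
`det_lorentz`). Hence ω⋆ω changes by a similarity and the factor r², det ω by the factor r⁴, and the
Lorentz singular values by the factor r; the points do not change.

The core is the diagonalization of strict witnesses, `IsStrictWitness.exists_normalForm`. Fix a
Pauli-diagonal state S of the form 1 + separable whose four coefficients have distinct absolute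
values, and minimize Tr(W M S M†) over M = A ⊗ B with A, B of determinant 1. Strictness makes this
function coercive, so a minimum exists. At the minimum the first-order conditions for M†WM form 2 ×
2 linear systems for pairs of off-diagonal coefficients. Distinctness makes these systems regular,
so M†WM is Pauli-diagonal. The group G acts on normal forms by local operations
(`stateEquiv_of_mem_orbit`), so the diagonal can be sorted, and a sorted diagonal is its own list of
singular values. This gives the classification of strict witnesses.

A general potential witness W is a limit of the strict witnesses W + ε·1. The conditions defining
singular values can be written as equations and weak inequalities, which survive ε → 0
(`exists_isLorentzSingularValues_of_approx`). The same limit carries the inequalities of the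
tetrahedron and the octahedron to all states and all separable states. Conversely, normal forms
realize every point: Bell vectors diagonalize them, which yields the tetrahedron, and trace duality
between cube and octahedron decides separability. Without strictness ω⋆ω may have a Jordan block,
which the singular values do not see; `jordanWitness` exploits this. -/

/-- The Hermitian one-qubit operator `∑ x_μ σ^μ`. -/
def bloch (x : Fin 4 → ℝ) : Op1 := ∑ μ, ((x μ : ℝ) : ℂ) • pauli μ

theorem bloch_eq (x : Fin 4 → ℝ) :
    bloch x = !![(x 0 : ℂ) + x 3, x 1 - Complex.I * x 2; x 1 + Complex.I * x 2, x 0 - x 3] := by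
  ext i j
  fin_cases i <;> fin_cases j <;> simp [bloch, Matrix.sum_apply, Fin.sum_univ_four, pauli] <;> ring

theorem bloch_isHermitian (x : Fin 4 → ℝ) : (bloch x).IsHermitian := by
  simp [Matrix.IsHermitian, bloch, Matrix.conjTranspose_sum, Matrix.conjTranspose_smul,
    pauli_hermitian]

theorem pauli_eq_bloch (μ : Fin 4) : pauli μ = bloch (Pi.single μ 1) := by
  simp only [bloch, Pi.single_apply]
  rw [Finset.sum_eq_single μ] <;> simp +contextual

/-- The Pauli coordinates of a Hermitian one-qubit operator. -/
def blochVector (a : Op1) (μ : Fin 4) : ℝ := (Matrix.trace (pauli μ * a)).re / 2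

theorem bloch_blochVector {a : Op1} (ha : a.IsHermitian) : bloch (blochVector a) = a := by
  have h := fun i j => congrFun (congrFun ha i) j
  have h00 := h 0 0
  have h01 := h 0 1
  have h11 := h 1 1
  simp only [Matrix.conjTranspose_apply, Complex.ext_iff, Complex.star_def, Complex.conj_re,
    Complex.conj_im] at h00 h01 h11
  rw [bloch_eq]
  ext i j
  fin_cases i <;> fin_cases j <;> apply Complex.ext <;>
    simp only [blochVector, Matrix.trace, Matrix.diag, Matrix.mul_apply, Fin.sum_univ_two] <;>
    simp [pauli] <;> linarith

/-- The closed forward light cone. -/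
def lightCone : Set (Fin 4 → ℝ) := {x | 0 ≤ x 0 ∧ x 1 ^ 2 + x 2 ^ 2 + x 3 ^ 2 ≤ x 0 ^ 2}

theorem trace_bloch (x : Fin 4 → ℝ) : (bloch x).trace = ((2 * x 0 : ℝ) : ℂ) := by
  rw [bloch_eq]
  simp [Matrix.trace, Fin.sum_univ_two]
  ring

theorem det_bloch (x : Fin 4 → ℝ) :
    (bloch x).det = ((x 0 ^ 2 - (x 1 ^ 2 + x 2 ^ 2 + x 3 ^ 2) : ℝ) : ℂ) := by
  rw [bloch_eq, Matrix.det_fin_two_of]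
  push_cast
  linear_combination (x 2 : ℂ) ^ 2 * Complex.I_sq

/-- Two real eigenvalues are nonnegative iff their sum and product are; here the sum is 2 x₀ and the
product is the Minkowski square of x. -/
theorem bloch_posSemidef_iff (x : Fin 4 → ℝ) : (bloch x).PosSemidef ↔ x ∈ lightCone := by
  constructor
  · intro h
    have h1 := h.trace_nonneg
    have h2 := h.det_nonneg
    rw [trace_bloch, Complex.zero_le_real] at h1
    rw [det_bloch, Complex.zero_le_real] at h2
    exact ⟨by linarith, by linarith⟩
  · rintro ⟨h1, h2⟩
    have hH := bloch_isHermitian x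
    have ht := hH.trace_eq_sum_eigenvalues
    have hd := hH.det_eq_prod_eigenvalues
    rw [trace_bloch, Fin.sum_univ_two] at ht
    rw [det_bloch, Fin.prod_univ_two] at hd
    have ht' : 2 * x 0 = hH.eigenvalues 0 + hH.eigenvalues 1 := by
      simpa using congrArg Complex.re ht
    have hd' : x 0 ^ 2 - (x 1 ^ 2 + x 2 ^ 2 + x 3 ^ 2) = hH.eigenvalues 0 * hH.eigenvalues 1 := by
      simpa [← Complex.ofReal_pow] using congrArg Complex.re hd
    rw [hH.posSemidef_iff_eigenvalues_nonneg, Pi.le_def]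
    refine Fin.forall_fin_two.2 ⟨?_, ?_⟩ <;> simp only [Pi.zero_apply] <;> by_contra! h <;> nlinarith

theorem exists_bloch_of_posSemidef {a : Op1} (ha : a.PosSemidef) :
    ∃ x ∈ lightCone, a = bloch x := by
  have h := bloch_blochVector ha.isHermitian
  exact ⟨_, (bloch_posSemidef_iff _).1 (by rwa [h]), h.symm⟩

theorem bloch_add (x y : Fin 4 → ℝ) : bloch (x + y) = bloch x + bloch y := by
  simp [bloch, add_smul, Finset.sum_add_distrib]

theorem lightCone_zero_pos {x : Fin 4 → ℝ} (hx : x ∈ lightCone) (h : x ≠ 0) : 0 < x 0 := by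
  refine lt_of_le_of_ne hx.1 fun h0 => h ?_
  have h2 := hx.2
  rw [← h0] at h2
  have h1 : x 1 = 0 := by nlinarith [sq_nonneg (x 1), sq_nonneg (x 2), sq_nonneg (x 3)]
  have h3 : x 2 = 0 := by nlinarith [sq_nonneg (x 1), sq_nonneg (x 2), sq_nonneg (x 3)]
  have h4 : x 3 = 0 := by nlinarith [sq_nonneg (x 1), sq_nonneg (x 2), sq_nonneg (x 3)]
  ext μ
  fin_cases μ <;> simp only [Pi.zero_apply] <;> first | assumption | exact h0.symm

/-! ### Potential witnesses in coordinates -/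

theorem trace_mul_bloch_kronecker (W : Op2) (x y : Fin 4 → ℝ) :
    (Matrix.trace (W * (bloch x ⊗ₖ bloch y))).re = 4 * (x ⬝ᵥ coeff W *ᵥ y) := by
  have h : bloch x ⊗ₖ bloch y = ∑ μ, ∑ ν, ((x μ * y ν : ℝ) : ℂ) • (pauli μ ⊗ₖ pauli ν) := by
    ext ⟨i, j⟩ ⟨k, l⟩
    simp only [bloch, Matrix.kroneckerMap_apply, Matrix.sum_apply, Matrix.smul_apply,
      Finset.sum_mul_sum, smul_eq_mul]
    refine Finset.sum_congr rfl fun μ _ => Finset.sum_congr rfl fun ν _ => ?_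
    push_cast
    ring
  rw [h]
  simp only [Matrix.trace_sum, Matrix.mul_smul, Matrix.trace_smul, Complex.re_sum,
    smul_eq_mul, Complex.re_ofReal_mul, dotProduct, Matrix.mulVec, Finset.mul_sum, coeff]
  refine Finset.sum_congr rfl fun μ _ => Finset.sum_congr rfl fun ν _ => ?_
  ring

theorem isSeparable_kronecker {a b : Op1} (ha : a.PosSemidef) (hb : b.PosSemidef) :
    IsSeparable (a ⊗ₖ b) :=
  ⟨1, fun _ => a, fun _ => b, fun _ => ha, fun _ => hb, by simp⟩

/-- Product states generate the separable cone, so positivity needs testing on them only. -/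
theorem isPotentialWitness_iff (W : Op2) : IsPotentialWitness W ↔
    W.IsHermitian ∧ ∀ x ∈ lightCone, ∀ y ∈ lightCone, 0 ≤ x ⬝ᵥ coeff W *ᵥ y := by
  refine and_congr_right fun _ => ⟨fun h x hx y hy => ?_, ?_⟩
  · have := h _ (isSeparable_kronecker ((bloch_posSemidef_iff x).2 hx)
      ((bloch_posSemidef_iff y).2 hy))
    rw [trace_mul_bloch_kronecker] at this
    linarith
  · rintro h ρ ⟨n, a, b, ha, hb, rfl⟩
    rw [Matrix.mul_sum, Matrix.trace_sum, Complex.re_sum]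
    refine Finset.sum_nonneg fun i _ => ?_
    obtain ⟨x, hx, hx'⟩ := exists_bloch_of_posSemidef (ha i)
    obtain ⟨y, hy, hy'⟩ := exists_bloch_of_posSemidef (hb i)
    rw [hx', hy', trace_mul_bloch_kronecker]
    linarith [h x hx y hy]

theorem IsStrictWitness.isPotentialWitness {W : Op2} (h : IsStrictWitness W) :
    IsPotentialWitness W := by
  refine ⟨h.1, fun ρ hρ => ?_⟩
  by_cases h0 : ρ = 0
  · simp [h0]
  · exact (h.2 ρ hρ h0).le

theorem isStrictWitness_iff (W : Op2) : IsStrictWitness W ↔ W.IsHermitian ∧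
    ∀ x ∈ lightCone, ∀ y ∈ lightCone, x ≠ 0 → y ≠ 0 → 0 < x ⬝ᵥ coeff W *ᵥ y := by
  refine and_congr_right fun hW => ⟨fun h x hx y hy hx0 hy0 => ?_, ?_⟩
  -- Strictness is assumed for nonzero ρ only; the trace 4 x₀ y₀ > 0 shows that this product does
  -- not vanish.
  · have hne : bloch x ⊗ₖ bloch y ≠ 0 := by
      intro h0
      have h1 := congrArg Matrix.trace h0
      rw [Matrix.trace_kronecker, trace_bloch, trace_bloch, Matrix.trace_zero] at h1
      have hx1 := lightCone_zero_pos hx hx0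
      have hy1 := lightCone_zero_pos hy hy0
      norm_cast at h1
      have : 0 < 2 * x 0 * (2 * y 0) := by positivity
      linarith
    have := h _ (isSeparable_kronecker ((bloch_posSemidef_iff x).2 hx)
      ((bloch_posSemidef_iff y).2 hy)) hne
    rw [trace_mul_bloch_kronecker] at this
    linarith
  · rintro h ρ ⟨n, a, b, ha, hb, rfl⟩ hne
    have key : ∀ i, 0 ≤ (Matrix.trace (W * (a i ⊗ₖ b i))).re ∧
        (a i ⊗ₖ b i ≠ 0 → 0 < (Matrix.trace (W * (a i ⊗ₖ b i))).re) := by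
      intro i
      obtain ⟨x, hx, hx'⟩ := exists_bloch_of_posSemidef (ha i)
      obtain ⟨y, hy, hy'⟩ := exists_bloch_of_posSemidef (hb i)
      rw [hx', hy', trace_mul_bloch_kronecker]
      by_cases hx0 : x = 0
      · subst hx0; simp [bloch]
      by_cases hy0 : y = 0
      · subst hy0; simp [bloch]
      have := h x hx y hy hx0 hy0
      exact ⟨by linarith, fun _ => by linarith⟩
    rw [Matrix.mul_sum, Matrix.trace_sum, Complex.re_sum]
    obtain ⟨i, -, hi⟩ := Finset.exists_ne_zero_of_sum_ne_zero hne
    exact Finset.sum_pos' (fun i _ => (key i).1) ⟨i, Finset.mem_univ i, (key i).2 hi⟩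

/-! ### The three cones -/

theorem IsSeparable.isState {ρ : Op2} (h : IsSeparable ρ) : IsState ρ := by
  obtain ⟨n, a, b, ha, hb, rfl⟩ := h
  exact Matrix.posSemidef_sum _ fun i _ => (ha i).kronecker (hb i)

-- For τ = B B† the pairing is Tr(B†ρB) ≥ 0; separability of τ enters only through its positivity.
open scoped MatrixOrder in
theorem IsState.isPotentialWitness {ρ : Op2} (h : IsState ρ) : IsPotentialWitness ρ := by
  refine ⟨h.isHermitian, fun τ hτ => ?_⟩
  obtain ⟨B, hB⟩ : ∃ B : Op2, τ = B * Bᴴ := by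
    obtain ⟨B, hB⟩ := CStarAlgebra.nonneg_iff_eq_star_mul_self.mp hτ.isState.nonneg
    exact ⟨Bᴴ, by simpa [Matrix.star_eq_conjTranspose] using hB⟩
  rw [hB, ← Matrix.mul_assoc, Matrix.trace_mul_comm, ← Matrix.mul_assoc]
  exact (Complex.le_def.1 (Matrix.PosSemidef.trace_nonneg
    (h.conjTranspose_mul_mul_same B))).1

theorem IsSeparable.add {ρ τ : Op2} (hρ : IsSeparable ρ) (hτ : IsSeparable τ) :
    IsSeparable (ρ + τ) := by
  obtain ⟨n, a, b, ha, hb, rfl⟩ := hρ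
  obtain ⟨m, c, d, hc, hd, rfl⟩ := hτ
  refine ⟨n + m, Fin.append a c, Fin.append b d, ?_, ?_, ?_⟩
  · intro i; refine Fin.addCases (fun j => ?_) (fun j => ?_) i <;> simp [ha, hc]
  · intro i; refine Fin.addCases (fun j => ?_) (fun j => ?_) i <;> simp [hb, hd]
  · simp [Fin.sum_univ_add]

theorem IsSeparable.smul {ρ : Op2} (hρ : IsSeparable ρ) {r : ℝ} (hr : 0 ≤ r) :
    IsSeparable ((r : ℂ) • ρ) := by
  obtain ⟨n, a, b, ha, hb, rfl⟩ := hρ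
  refine ⟨n, fun i => (r : ℂ) • a i, b, fun i => (ha i).smul (by exact_mod_cast hr), hb, ?_⟩
  simp [Finset.smul_sum, Matrix.smul_kronecker]

/-! ### Local operations -/

/-- The action of the local operation `A ⊗ B`. -/
def conjLocal (A B : Op1) (W : Op2) : Op2 := (A ⊗ₖ B) * W * (A ⊗ₖ B)ᴴ

theorem conjLocal_kronecker (A B a b : Op1) :
    conjLocal A B (a ⊗ₖ b) = (A * a * Aᴴ) ⊗ₖ (B * b * Bᴴ) := by
  simp [conjLocal, Matrix.mul_kronecker_mul, Matrix.conjTranspose_kronecker]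

theorem conjLocal_conjLocal (A B A' B' : Op1) (W : Op2) :
    conjLocal A B (conjLocal A' B' W) = conjLocal (A * A') (B * B') W := by
  simp [conjLocal, Matrix.mul_kronecker_mul, Matrix.mul_assoc]

theorem conjLocal_one (W : Op2) : conjLocal 1 1 W = W := by
  simp [conjLocal]

theorem conjLocal_smul (A B : Op1) (c : ℂ) (W : Op2) :
    conjLocal A B (c • W) = c • conjLocal A B W := by
  simp [conjLocal]

theorem conjLocal_sum {ι : Type*} (s : Finset ι) (A B : Op1) (W : ι → Op2) :
    conjLocal A B (∑ i ∈ s, W i) = ∑ i ∈ s, conjLocal A B (W i) := by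
  simp [conjLocal, Matrix.mul_sum, Matrix.sum_mul]

theorem conjLocal_add (A B : Op1) (V W : Op2) :
    conjLocal A B (V + W) = conjLocal A B V + conjLocal A B W := by
  simp [conjLocal, mul_add, add_mul]

theorem conjLocal_smul_smul (A B : Op1) (c d : ℂ) (W : Op2) :
    conjLocal (c • A) (d • B) W = ((‖c * d‖ ^ 2 : ℝ) : ℂ) • conjLocal A B W := by
  simp only [conjLocal, Matrix.smul_kronecker, Matrix.kronecker_smul, Matrix.conjTranspose_smul,
    smul_smul, Matrix.smul_mul, Matrix.mul_smul]
  congr 1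
  rw [← Complex.normSq_eq_norm_sq, Complex.normSq_eq_conj_mul_self]
  simp
  ring

theorem trace_conjLocal_mul (A B : Op1) (W ρ : Op2) :
    (conjLocal A B W * ρ).trace = (W * conjLocal Aᴴ Bᴴ ρ).trace := by
  simp only [conjLocal, Matrix.conjTranspose_kronecker, Matrix.conjTranspose_conjTranspose]
  rw [Matrix.mul_assoc, Matrix.mul_assoc, Matrix.trace_mul_comm]
  simp only [Matrix.mul_assoc]

theorem IsSeparable.conjLocal {ρ : Op2} (hρ : IsSeparable ρ) (A B : Op1) :
    IsSeparable (conjLocal A B ρ) := by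
  obtain ⟨n, a, b, ha, hb, rfl⟩ := hρ
  refine ⟨n, fun i => A * a i * Aᴴ, fun i => B * b i * Bᴴ,
    fun i => (ha i).mul_mul_conjTranspose_same A, fun i => (hb i).mul_mul_conjTranspose_same B, ?_⟩
  simp only [conjLocal_sum, conjLocal_kronecker]

theorem isHermitian_conjLocal {W : Op2} (hW : W.IsHermitian) (A B : Op1) :
    (conjLocal A B W).IsHermitian :=
  Matrix.isHermitian_mul_mul_conjTranspose _ hW

theorem stateEquiv_iff (W W' : Op2) : StateEquiv W W' ↔
    ∃ r : ℝ, 0 < r ∧ ∃ A B : Op1, A.det = 1 ∧ B.det = 1 ∧ W' = (r : ℂ) • conjLocal A B W := by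
  constructor
  · rintro ⟨r, hr, A, B, h⟩
    exact ⟨r, hr, A, B, A.2, B.2, h⟩
  · rintro ⟨r, hr, A, B, hA, hB, h⟩
    exact ⟨r, hr, ⟨A, hA⟩, ⟨B, hB⟩, h⟩

theorem isHermitian_real_smul {W : Op2} (hW : W.IsHermitian) (r : ℝ) :
    ((r : ℂ) • W).IsHermitian := by
  simp [Matrix.IsHermitian, Matrix.conjTranspose_smul, hW.eq]

/-- Square roots of the inverse determinants normalize A and B, and the scalars affect the action
only through a positive factor. So local operations need only be invertible. -/
theorem stateEquiv_smul_conjLocal (W : Op2) {A B : Op1} (hA : A.det ≠ 0) (hB : B.det ≠ 0)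
    {r : ℝ} (hr : 0 < r) : StateEquiv W ((r : ℂ) • conjLocal A B W) := by
  obtain ⟨c, hc⟩ := IsAlgClosed.exists_pow_nat_eq (A.det)⁻¹ (n := 2) (by norm_num)
  obtain ⟨d, hd⟩ := IsAlgClosed.exists_pow_nat_eq (B.det)⁻¹ (n := 2) (by norm_num)
  have hc0 : c ≠ 0 := by rintro rfl; simp at hc; exact hA hc.symm
  have hd0 : d ≠ 0 := by rintro rfl; simp at hd; exact hB hd.symm
  have hn : 0 < ‖c * d‖ ^ 2 := by
    have := norm_pos_iff.2 (mul_ne_zero hc0 hd0)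
    positivity
  refine (stateEquiv_iff _ _).2 ⟨r / ‖c * d‖ ^ 2, by positivity, c • A, d • B, ?_, ?_, ?_⟩
  · simp [hc, hA]
  · simp [hd, hB]
  · rw [conjLocal_smul_smul, smul_smul, ← Complex.ofReal_mul, div_mul_cancel₀ _ hn.ne']

theorem stateEquiv_refl (W : Op2) : StateEquiv W W :=
  (stateEquiv_iff _ _).2 ⟨1, one_pos, 1, 1, by simp, by simp, by simp [conjLocal_one]⟩

theorem StateEquiv.trans {W W' W'' : Op2} (h : StateEquiv W W') (h' : StateEquiv W' W'') :
    StateEquiv W W'' := by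
  rw [stateEquiv_iff] at *
  obtain ⟨r, hr, A, B, hA, hB, rfl⟩ := h
  obtain ⟨r', hr', A', B', hA', hB', rfl⟩ := h'
  refine ⟨r' * r, by positivity, A' * A, B' * B, by simp [hA, hA'], by simp [hB, hB'], ?_⟩
  rw [conjLocal_smul, conjLocal_conjLocal, smul_smul, Complex.ofReal_mul]

theorem conjLocal_inv {A B : Op1} (hA : A.det = 1) (hB : B.det = 1) (W : Op2) :
    conjLocal A⁻¹ B⁻¹ (conjLocal A B W) = W := by
  rw [conjLocal_conjLocal, Matrix.nonsing_inv_mul _ (by simp [hA]),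
    Matrix.nonsing_inv_mul _ (by simp [hB]), conjLocal_one]

theorem StateEquiv.symm {W W' : Op2} (h : StateEquiv W W') : StateEquiv W' W := by
  rw [stateEquiv_iff] at *
  obtain ⟨r, hr, A, B, hA, hB, rfl⟩ := h
  refine ⟨r⁻¹, by positivity, A⁻¹, B⁻¹, by simp [Matrix.det_nonsing_inv, hA],
    by simp [Matrix.det_nonsing_inv, hB], ?_⟩
  rw [conjLocal_smul, conjLocal_inv hA hB, smul_smul, ← Complex.ofReal_mul,
    inv_mul_cancel₀ hr.ne']
  simp

/-- The map A ↦ (A†)⁻¹ is an involution of SL(2, ℂ) that exchanges the two actions. -/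
theorem witnessEquiv_iff_stateEquiv (W W' : Op2) : WitnessEquiv W W' ↔ StateEquiv W W' := by
  have key : ∀ A B : Matrix.SpecialLinearGroup (Fin 2) ℂ,
      witnessAction A B W = conjLocal ((A : Op1)ᴴ)⁻¹ ((B : Op1)ᴴ)⁻¹ W := by
    intro A B
    simp only [witnessAction, conjLocal, localOp, Matrix.conjTranspose_kronecker,
      Matrix.inv_kronecker, Matrix.conjTranspose_nonsing_inv, Matrix.conjTranspose_conjTranspose]
  rw [stateEquiv_iff]
  constructor
  · rintro ⟨r, hr, A, B, rfl⟩
    refine ⟨r, hr, _, _, ?_, ?_, by rw [key]⟩ <;>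
      simp [Matrix.det_nonsing_inv, Matrix.det_conjTranspose]
  · rintro ⟨r, hr, A, B, hA, hB, rfl⟩
    have lift : ∀ C : Op1, C.det = 1 →
        ∃ C' : Matrix.SpecialLinearGroup (Fin 2) ℂ, (C' : Op1) = Cᴴ⁻¹ := fun C hC =>
      ⟨⟨Cᴴ⁻¹, by simp [Matrix.det_nonsing_inv, Matrix.det_conjTranspose, hC]⟩, rfl⟩
    obtain ⟨A', hA'⟩ := lift A hA
    obtain ⟨B', hB'⟩ := lift B hB
    refine ⟨r, hr, A', B', ?_⟩
    rw [key, hA', hB']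
    simp only [← Matrix.conjTranspose_nonsing_inv, Matrix.conjTranspose_conjTranspose]
    rw [Matrix.nonsing_inv_nonsing_inv _ (by simp [hA]),
      Matrix.nonsing_inv_nonsing_inv _ (by simp [hB])]

theorem StateEquiv.isSeparable {W W' : Op2} (h : StateEquiv W W') (hW : IsSeparable W) :
    IsSeparable W' := by
  obtain ⟨r, hr, A, B, -, -, rfl⟩ := (stateEquiv_iff _ _).1 h
  exact (hW.conjLocal A B).smul hr.le

theorem StateEquiv.isState {W W' : Op2} (h : StateEquiv W W') (hW : IsState W) : IsState W' := by
  obtain ⟨r, hr, A, B, -, -, rfl⟩ := (stateEquiv_iff _ _).1 h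
  exact Matrix.PosSemidef.smul (hW.mul_mul_conjTranspose_same _) (by exact_mod_cast hr.le)

theorem re_trace_smul_mul (r : ℝ) (V ρ : Op2) :
    (Matrix.trace (((r : ℂ) • V) * ρ)).re = r * (Matrix.trace (V * ρ)).re := by
  simp [Matrix.trace_smul]

theorem StateEquiv.isPotentialWitness {W W' : Op2} (h : StateEquiv W W')
    (hW : IsPotentialWitness W) : IsPotentialWitness W' := by
  obtain ⟨r, hr, A, B, -, -, rfl⟩ := (stateEquiv_iff _ _).1 h
  refine ⟨isHermitian_real_smul (isHermitian_conjLocal hW.1 A B) r, fun ρ hρ => ?_⟩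
  rw [re_trace_smul_mul, trace_conjLocal_mul]
  exact mul_nonneg hr.le (hW.2 _ (hρ.conjLocal _ _))

theorem StateEquiv.isStrictWitness {W W' : Op2} (h : StateEquiv W W')
    (hW : IsStrictWitness W) : IsStrictWitness W' := by
  obtain ⟨r, hr, A, B, hA, hB, rfl⟩ := (stateEquiv_iff _ _).1 h
  refine ⟨isHermitian_real_smul (isHermitian_conjLocal hW.1 A B) r, fun ρ hρ h0 => ?_⟩
  rw [re_trace_smul_mul, trace_conjLocal_mul]
  refine mul_pos hr (hW.2 _ (hρ.conjLocal _ _) fun h1 => h0 ?_)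
  rw [← conjLocal_inv (A := Aᴴ) (B := Bᴴ) (by simp [Matrix.det_conjTranspose, hA])
    (by simp [Matrix.det_conjTranspose, hB]) ρ, h1]
  simp [conjLocal]

/-! ### Vectorization in the Pauli basis -/

/-- The matrix whose columns are the vectorized Pauli matrices. -/
def pauliVec : Matrix (Fin 2 × Fin 2) (Fin 4) ℂ := fun p μ => pauli μ p.1 p.2

/-- Trace orthogonality of the Pauli matrices: `pauliVec` is √2 times a unitary. This basis change
serves both for the determinant of `lorentz A` and for the Bell diagonalization of canonical forms.
-/
theorem conjTranspose_pauliVec_mul : ((1 / 2 : ℂ) • pauliVecᴴ) * pauliVec = 1 := by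
  ext μ ν
  simp only [Matrix.mul_apply, Fintype.sum_prod_type, Fin.sum_univ_two, Matrix.smul_apply,
    Matrix.conjTranspose_apply, pauliVec]
  fin_cases μ <;> fin_cases ν <;> simp [pauli] <;> first | (norm_num; done) | (ring_nf; norm_num)

theorem pauliVec_mul_conjTranspose : pauliVec * ((1 / 2 : ℂ) • pauliVecᴴ) = 1 := by
  ext ⟨i, j⟩ ⟨k, l⟩
  simp only [Matrix.mul_apply, Fin.sum_univ_four, Matrix.smul_apply,
    Matrix.conjTranspose_apply, pauliVec]
  fin_cases i <;> fin_cases j <;> fin_cases k <;> fin_cases l <;> simp [pauli] <;> ring_nf <;>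
    norm_num [Complex.I_sq]

/-! ### Lorentz transformations -/

/-- The matrix of `X ↦ A X A†` in Pauli coordinates. -/
def lorentz (A : Op1) : Matrix (Fin 4) (Fin 4) ℝ := fun α μ => blochVector (A * pauli μ * Aᴴ) α

theorem bloch_lorentz (A : Op1) (μ : Fin 4) :
    bloch (fun α => lorentz A α μ) = A * pauli μ * Aᴴ :=
  bloch_blochVector (Matrix.isHermitian_mul_mul_conjTranspose _ (pauli_hermitian μ))

theorem coeff_smul (r : ℝ) (W : Op2) : coeff ((r : ℂ) • W) = r • coeff W := by
  ext μ ν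
  simp [coeff, Matrix.trace_smul]
  ring

theorem coeff_add (V W : Op2) : coeff (V + W) = coeff V + coeff W := by
  ext μ ν
  simp [coeff, add_mul]
  ring

theorem coeff_conjLocal (A B : Op1) (W : Op2) :
    coeff (conjLocal A B W) = (lorentz Aᴴ)ᵀ * coeff W * lorentz Bᴴ := by
  ext μ ν
  rw [coeff, trace_conjLocal_mul, conjLocal_kronecker, ← bloch_lorentz, ← bloch_lorentz,
    trace_mul_bloch_kronecker, mul_div_cancel_left₀ _ four_ne_zero, Matrix.mul_assoc,
    Matrix.mul_apply_eq_vecMul]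
  simp only [Matrix.mul_apply, dotProduct, Matrix.mulVec, Matrix.vecMul, Matrix.transpose_apply]

theorem dotProduct_minkowski (x y : Fin 4 → ℝ) :
    x ⬝ᵥ minkowski *ᵥ y = x 0 * y 0 - x 1 * y 1 - x 2 * y 2 - x 3 * y 3 := by
  simp [minkowski, Matrix.mulVec_diagonal, dotProduct, Fin.sum_univ_four]
  ring

theorem trace_mul_adjugate_bloch (x y : Fin 4 → ℝ) :
    (bloch x * (bloch y).adjugate).trace = ((2 * (x ⬝ᵥ minkowski *ᵥ y) : ℝ) : ℂ) := by
  rw [dotProduct_minkowski, bloch_eq, bloch_eq, Matrix.adjugate_fin_two_of]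
  simp [Matrix.trace, Fin.sum_univ_two]
  linear_combination (2 * (x 2 : ℂ) * y 2) * Complex.I_sq

/-- The Minkowski form is the polarized determinant, x·ηy = ½ Tr(X adj Y), and X ↦ A X A† preserves
it when det A = 1. -/
theorem lorentz_transpose_mul {A : Op1} (hA : A.det = 1) :
    (lorentz A)ᵀ * minkowski * lorentz A = minkowski := by
  have h : ∀ X Y : Op1,
      (A * X * Aᴴ * (A * Y * Aᴴ).adjugate).trace = (X * Y.adjugate).trace := by
    intro X Y
    have h1 : Aᴴ * (Aᴴ).adjugate = 1 := by
      rw [Matrix.mul_adjugate, Matrix.det_conjTranspose, hA]; simp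
    have h2 : A.adjugate * A = 1 := by rw [Matrix.adjugate_mul, hA, one_smul]
    rw [Matrix.adjugate_mul_distrib, Matrix.adjugate_mul_distrib]
    calc _ = (A * X * (Aᴴ * (Aᴴ).adjugate) * Y.adjugate * A.adjugate).trace := by
          simp only [Matrix.mul_assoc]
      _ = (A.adjugate * A * X * Y.adjugate).trace := by
          rw [h1, Matrix.mul_one, Matrix.trace_mul_comm]; simp only [Matrix.mul_assoc]
      _ = _ := by rw [h2, Matrix.one_mul]
  ext μ ν
  have h1 := h (pauli μ) (pauli ν)
  rw [← bloch_lorentz, ← bloch_lorentz, pauli_eq_bloch, pauli_eq_bloch, trace_mul_adjugate_bloch,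
    trace_mul_adjugate_bloch, Complex.ofReal_inj] at h1
  have h2 := mul_left_cancel₀ two_ne_zero h1
  rw [Matrix.mul_assoc, Matrix.mul_apply_eq_vecMul]
  simpa [Matrix.mul_apply, dotProduct, Matrix.mulVec, Matrix.vecMul, Pi.single_apply] using h2

theorem minkowski_mul_minkowski : minkowski * minkowski = 1 := by
  rw [minkowski, Matrix.diagonal_mul_diagonal, ← Matrix.diagonal_one]
  congr 1
  ext i
  fin_cases i <;> simp

theorem minkowskiAdjoint_lorentz_mul {A : Op1} (hA : A.det = 1) :
    minkowskiAdjoint (lorentz A) * lorentz A = 1 := by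
  rw [minkowskiAdjoint, Matrix.mul_assoc, Matrix.mul_assoc, ← Matrix.mul_assoc _ minkowski,
    lorentz_transpose_mul hA, minkowski_mul_minkowski]

theorem lorentz_mul_minkowskiAdjoint {A : Op1} (hA : A.det = 1) :
    lorentz A * minkowskiAdjoint (lorentz A) = 1 :=
  mul_eq_one_comm.1 (minkowskiAdjoint_lorentz_mul hA)

theorem kronecker_map_star_mul_pauliVec (A : Op1) :
    (A ⊗ₖ A.map star) * pauliVec = pauliVec * (lorentz A).map ((↑) : ℝ → ℂ) := by
  ext ⟨i, j⟩ μ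
  have h := congrFun (congrFun (bloch_lorentz A μ) i) j
  simp only [bloch, Matrix.sum_apply, Matrix.smul_apply, smul_eq_mul] at h
  simp only [Matrix.mul_apply, pauliVec, Matrix.map_apply, Fintype.sum_prod_type,
    Matrix.kroneckerMap_apply, Matrix.conjTranspose_apply, Fin.sum_univ_two] at h ⊢
  simp only [mul_comm (pauli _ i j)]
  rw [h]
  ring

/-- On vectorized matrices X ↦ A X A† is A ⊗ Ā, of determinant (det A)² (det Ā)² = 1, and `pauliVec`
conjugates it to `lorentz A`. The sign of det ω is an invariant for this reason. -/
theorem det_lorentz {A : Op1} (hA : A.det = 1) : (lorentz A).det = 1 := by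
  have h1 : (lorentz A).map ((↑) : ℝ → ℂ) =
      ((1 / 2 : ℂ) • pauliVecᴴ) * (A ⊗ₖ A.map star) * pauliVec := by
    rw [Matrix.mul_assoc, kronecker_map_star_mul_pauliVec, ← Matrix.mul_assoc,
      conjTranspose_pauliVec_mul, Matrix.one_mul]
  have h2 : ((lorentz A).map ((↑) : ℝ → ℂ)).det = 1 := by
    rw [h1, Matrix.det_conj_of_mul_eq_one conjTranspose_pauliVec_mul pauliVec_mul_conjTranspose,
      Matrix.det_kronecker]
    have h3 : (A.map star).det = 1 := by
      rw [← Matrix.conjTranspose_transpose, Matrix.det_transpose, Matrix.det_conjTranspose, hA,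
        star_one]
    rw [hA, h3]
    simp
  have h4 := RingHom.map_det Complex.ofRealHom (lorentz A)
  have h5 : ((lorentz A).det : ℂ) = 1 := h4.trans h2
  exact_mod_cast h5

/-- The matrix `ω⋆ω`, whose eigenvalues are the squared Lorentz singular values. -/
def gram (W : Op2) : Matrix (Fin 4) (Fin 4) ℝ := minkowskiAdjoint (coeff W) * coeff W

theorem minkowskiAdjoint_mul (M N : Matrix (Fin 4) (Fin 4) ℝ) :
    minkowskiAdjoint (M * N) = minkowskiAdjoint N * minkowskiAdjoint M := by
  simp only [minkowskiAdjoint, Matrix.transpose_mul, Matrix.mul_assoc]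
  rw [← Matrix.mul_assoc minkowski minkowski, minkowski_mul_minkowski, Matrix.one_mul]

theorem minkowskiAdjoint_transpose (M : Matrix (Fin 4) (Fin 4) ℝ) :
    minkowskiAdjoint Mᵀ = (minkowskiAdjoint M)ᵀ := by
  simp [minkowskiAdjoint, Matrix.transpose_mul, Matrix.mul_assoc, minkowski]

/-- Alice's Lorentz matrix cancels against its Minkowski adjoint, while Bob's acts by conjugation,
its Minkowski adjoint being its inverse. -/
theorem gram_smul_conjLocal (r : ℝ) {A : Op1} (hA : A.det = 1) (B : Op1) (W : Op2) :
    gram ((r : ℂ) • conjLocal A B W) =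
      r ^ 2 • (minkowskiAdjoint (lorentz Bᴴ) * gram W * lorentz Bᴴ) := by
  have hA' : (Aᴴ).det = 1 := by simp [Matrix.det_conjTranspose, hA]
  have h1 : minkowskiAdjoint (lorentz Aᴴ)ᵀ * (lorentz Aᴴ)ᵀ = 1 := by
    rw [minkowskiAdjoint_transpose, ← Matrix.transpose_mul, lorentz_mul_minkowskiAdjoint hA',
      Matrix.transpose_one]
  have h2 : ∀ M, minkowskiAdjoint (r • M) = r • minkowskiAdjoint M := by
    intro M; simp [minkowskiAdjoint, Matrix.transpose_smul]
  rw [gram, coeff_smul, coeff_conjLocal, h2, minkowskiAdjoint_mul, minkowskiAdjoint_mul,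
    Matrix.smul_mul, Matrix.mul_smul, smul_smul, ← sq, gram]
  congr 1
  calc _ = minkowskiAdjoint (lorentz Bᴴ) * minkowskiAdjoint (coeff W) *
        (minkowskiAdjoint (lorentz Aᴴ)ᵀ * (lorentz Aᴴ)ᵀ) * coeff W * lorentz Bᴴ := by
        simp only [Matrix.mul_assoc]
    _ = _ := by rw [h1, Matrix.mul_one]; simp only [Matrix.mul_assoc]

theorem det_coeff_smul_conjLocal (r : ℝ) {A B : Op1} (hA : A.det = 1) (hB : B.det = 1) (W : Op2) :
    (coeff ((r : ℂ) • conjLocal A B W)).det = r ^ 4 * (coeff W).det := by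
  rw [coeff_smul, coeff_conjLocal, Matrix.det_smul, Matrix.det_mul, Matrix.det_mul,
    Matrix.det_transpose, det_lorentz (by simp [Matrix.det_conjTranspose, hA]),
    det_lorentz (by simp [Matrix.det_conjTranspose, hB])]
  simp

theorem det_sub_gram_smul_conjLocal {r : ℝ} (hr : r ≠ 0) {A B : Op1} (hA : A.det = 1)
    (hB : B.det = 1) (W : Op2) (t : ℝ) :
    (Matrix.scalar (Fin 4) t - gram ((r : ℂ) • conjLocal A B W)).det =
      r ^ 8 * (Matrix.scalar (Fin 4) (t / r ^ 2) - gram W).det := by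
  have hB' : (Bᴴ).det = 1 := by simp [Matrix.det_conjTranspose, hB]
  have h1 := minkowskiAdjoint_lorentz_mul hB'
  have h2 := lorentz_mul_minkowskiAdjoint hB'
  have h3 : Matrix.scalar (Fin 4) t - gram ((r : ℂ) • conjLocal A B W) =
      r ^ 2 • (minkowskiAdjoint (lorentz Bᴴ) * (Matrix.scalar (Fin 4) (t / r ^ 2) - gram W) *
        lorentz Bᴴ) := by
    rw [gram_smul_conjLocal r hA, Matrix.mul_sub, Matrix.sub_mul, smul_sub]
    congr 1
    rw [Matrix.scalar_apply, ← Matrix.smul_one_eq_diagonal, Matrix.scalar_apply,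
      ← Matrix.smul_one_eq_diagonal, Matrix.mul_smul, Matrix.mul_one, Matrix.smul_mul, h1, smul_smul,
      mul_div_cancel₀ _ (pow_ne_zero 2 hr)]
  rw [h3, Matrix.det_smul, Matrix.det_conj_of_mul_eq_one h1 h2]
  simp only [Fintype.card_fin]
  ring

/-! ### The tetrahedral group, the cube, the tetrahedron and the octahedron -/

/-- A permutation of the coordinates followed by sign flips. -/
def signedPerm (π : Equiv.Perm (Fin 3)) (ε : Fin 3 → ℤˣ) : (Fin 3 → ℝ) ≃ₗ[ℝ] (Fin 3 → ℝ) where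
  toFun v i := ((ε i : ℤ) : ℝ) * v (π i)
  invFun v i := ((ε (π⁻¹ i) : ℤ) : ℝ) * v (π⁻¹ i)
  map_add' v w := by ext i; simp [mul_add]
  map_smul' c v := by ext i; simp; ring
  left_inv v := by
    ext i
    have h : π (π⁻¹ i) = i := π.apply_symm_apply i
    simp only [h]
    rcases Int.units_eq_one_or (ε (π⁻¹ i)) with h | h <;> rw [h] <;> simp
  right_inv v := by
    ext i
    rcases Int.units_eq_one_or (ε i) with h | h <;> simp [h]

theorem mem_orbit_iff {u v : Fin 3 → ℝ} : v ∈ MulAction.orbit tetrahedralGroup u ↔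
    ∃ (π : Equiv.Perm (Fin 3)) (ε : Fin 3 → ℤˣ), ∏ i, ε i = 1 ∧
      v = fun i => ((ε i : ℤ) : ℝ) * u (π i) := by
  constructor
  · rintro ⟨⟨g, π, ε, hε, hg⟩, rfl⟩
    exact ⟨π, ε, hε, funext fun i => hg u i⟩
  · rintro ⟨π, ε, hε, rfl⟩
    exact ⟨⟨signedPerm π ε, π, ε, hε, fun v i => rfl⟩, rfl⟩

theorem card_tetrahedralGroup : Nat.card tetrahedralGroup = 24 := by
  let f : Equiv.Perm (Fin 3) × ℤˣ × ℤˣ → tetrahedralGroup := fun p =>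
    ⟨signedPerm p.1 ![p.2.1, p.2.2, p.2.1 * p.2.2], p.1, _, by
      rw [Fin.prod_univ_three]
      simp only [Matrix.cons_val]
      rw [mul_mul_mul_comm, ← mul_assoc, Int.units_mul_self, one_mul, Int.units_mul_self],
      fun v i => rfl⟩
  have hsign : ∀ {e e' : ℤˣ} {a b : ℝ}, 0 < a → 0 < b → ((e : ℤ) : ℝ) * a = ((e' : ℤ) : ℝ) * b →
      e = e' ∧ a = b := by
    intro e e' a b ha hb h
    rcases Int.units_eq_one_or e with rfl | rfl <;> rcases Int.units_eq_one_or e' with rfl | rfl <;>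
      simp at h ⊢ <;> linarith
  have hf : Function.Bijective f := by
    constructor
    · rintro ⟨π, a, b⟩ ⟨π', a', b'⟩ h
      -- The test vector (1, 2, 3) has distinct positive entries, so its image determines both the
      -- signs and the permutation.
      have h1 : ∀ i, signedPerm π ![a, b, a * b] (fun i => (i : ℕ) + 1) i =
          signedPerm π' ![a', b', a' * b'] (fun i => (i : ℕ) + 1) i :=
        fun i => congrFun (congrArg (fun g : tetrahedralGroup => g.1 (fun i => (i : ℕ) + 1)) h) i
      have h2 := fun i => hsign (by positivity) (by positivity) (h1 i)
      have hπ : π = π' := by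
        ext i
        have := (h2 i).2
        simp only [add_left_inj, Nat.cast_inj] at this
        exact this
      have ha : a = a' := (h2 0).1
      have hb : b = b' := (h2 1).1
      rw [hπ, ha, hb]
    · rintro ⟨g, π, ε, hε, hg⟩
      refine ⟨(π, ε 0, ε 1), Subtype.ext (LinearEquiv.ext fun v => funext fun i => ?_)⟩
      rw [hg]
      have h2 : ε 0 * ε 1 = ε 2 := by
        rw [Fin.prod_univ_three] at hε
        rw [← mul_one (ε 0 * ε 1), ← Int.units_mul_self (ε 2), ← mul_assoc, hε, one_mul]
      change (((![ε 0, ε 1, ε 0 * ε 1] : Fin 3 → ℤˣ) i : ℤ) : ℝ) * v (π i) = _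
      rw [h2]
      fin_cases i <;> rfl
  rw [← Nat.card_eq_of_bijective f hf]
  simp [Nat.card_eq_fintype_card, Fintype.card_perm, Nat.factorial]

/-- With ε₃ = -ε₁ε₂ the inequalities range over all sign triples of product -1, a family that G
visibly permutes. -/
theorem mem_tetrahedron_iff (x : Fin 3 → ℝ) : x ∈ tetrahedron ↔
    ∀ ε : Fin 3 → ℤˣ, ∏ i, ε i = -1 → 0 ≤ 1 + ∑ i, ((ε i : ℤ) : ℝ) * x i := by
  constructor
  · intro h ε hε
    have h1 := h (ε 0) (ε 1)
    have h2 : ε 2 = -(ε 0 * ε 1) := by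
      rw [Fin.prod_univ_three] at hε
      rw [← one_mul (ε 2), ← Int.units_mul_self (ε 0 * ε 1), mul_assoc, hε, mul_neg_one]
    rw [Fin.sum_univ_three, h2]
    push_cast
    linarith
  · intro h ε₁ ε₂
    have h1 := h ![ε₁, ε₂, -(ε₁ * ε₂)] (by
      rw [Fin.prod_univ_three]
      simp only [Matrix.cons_val]
      rw [mul_neg, Int.units_mul_self])
    rw [Fin.sum_univ_three] at h1
    simp only [Matrix.cons_val] at h1
    push_cast at h1
    linarith

theorem mem_tetrahedron_of_mem_orbit {u v : Fin 3 → ℝ}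
    (hv : v ∈ MulAction.orbit tetrahedralGroup u) (hu : u ∈ tetrahedron) : v ∈ tetrahedron := by
  obtain ⟨π, ε, hε, rfl⟩ := mem_orbit_iff.1 hv
  rw [mem_tetrahedron_iff] at hu ⊢
  intro δ hδ
  have h := hu (fun i => δ (π⁻¹ i) * ε (π⁻¹ i)) (by
    rw [Equiv.prod_comp π⁻¹ (fun i => δ i * ε i), Finset.prod_mul_distrib, hδ, hε, mul_one])
  rw [← Equiv.sum_comp π] at h
  convert h using 3 with i
  simp
  ring

theorem image_tetrahedron (g : (Fin 3 → ℝ) ≃ₗ[ℝ] (Fin 3 → ℝ)) (hg : g ∈ tetrahedralGroup) :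
    g '' tetrahedron = tetrahedron := by
  have h : ∀ g ∈ tetrahedralGroup, ∀ x ∈ tetrahedron, g x ∈ tetrahedron := fun g hg x hx =>
    mem_tetrahedron_of_mem_orbit ⟨⟨g, hg⟩, rfl⟩ hx
  refine Set.Subset.antisymm (Set.image_subset_iff.2 (h g hg)) fun x hx => ?_
  exact ⟨g⁻¹ x, h _ (inv_mem hg) x hx, g.apply_symm_apply x⟩

theorem abs_units_mul (e : ℤˣ) (a : ℝ) : |((e : ℤ) : ℝ) * a| = |a| := by
  rcases Int.units_eq_one_or e with rfl | rfl <;> simp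

theorem mem_cube_of_mem_orbit {u v : Fin 3 → ℝ}
    (hv : v ∈ MulAction.orbit tetrahedralGroup u) (hu : u ∈ cube) : v ∈ cube := by
  obtain ⟨π, ε, hε, rfl⟩ := mem_orbit_iff.1 hv
  intro i
  rw [abs_units_mul]
  exact hu (π i)

theorem mem_openCube_of_mem_orbit {u v : Fin 3 → ℝ}
    (hv : v ∈ MulAction.orbit tetrahedralGroup u) (hu : u ∈ openCube) : v ∈ openCube := by
  obtain ⟨π, ε, hε, rfl⟩ := mem_orbit_iff.1 hv
  intro i
  rw [abs_units_mul]
  exact hu (π i)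

theorem openCube_subset_cube : openCube ⊆ cube := fun _ hx i => (hx i).le

theorem octahedron_subset_polar_cube : octahedron ⊆ polar cube := by
  refine convexHull_min ?_ ?_
  · rintro x ⟨i, rfl | rfl⟩ y hy
    · have := abs_le.1 (hy i)
      simp; linarith
    · have := abs_le.1 (hy i)
      simp; linarith
  · intro a ha b hb s t hs ht hst x hx
    have h1 := ha x hx
    have h2 := hb x hx
    rw [dotProduct_add, dotProduct_smul, dotProduct_smul, smul_eq_mul, smul_eq_mul]
    nlinarith [mul_nonneg hs h1, mul_nonneg ht h2]

theorem sum_abs_le_one_of_mem_polar_cube {y : Fin 3 → ℝ} (hy : y ∈ polar cube) :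
    ∑ i, |y i| ≤ 1 := by
  -- Test against the vertex of the cube whose signs are opposite to those of y.
  have h := hy (fun i => if 0 ≤ y i then -1 else 1) (fun i => by
    dsimp only
    split_ifs <;> simp)
  have h2 : (fun i => if 0 ≤ y i then (-1 : ℝ) else 1) ⬝ᵥ y = -∑ i, |y i| := by
    rw [dotProduct, ← Finset.sum_neg_distrib]
    refine Finset.sum_congr rfl fun i _ => ?_
    split_ifs with h
    · rw [abs_of_nonneg h]; ring
    · rw [abs_of_neg (not_le.1 h)]; ring
  rw [h2] at h
  linarith

theorem mem_octahedron_of_sum_abs_le_one {y : Fin 3 → ℝ} (hy : ∑ i, |y i| ≤ 1) :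
    y ∈ octahedron := by
  have hc : Convex ℝ octahedron := convex_convexHull ℝ _
  have hp : ∀ i, (Pi.single i 1 : Fin 3 → ℝ) ∈ octahedron := fun i =>
    subset_convexHull ℝ _ ⟨i, Or.inl rfl⟩
  have hm : ∀ i, (-Pi.single i 1 : Fin 3 → ℝ) ∈ octahedron := fun i =>
    subset_convexHull ℝ _ ⟨i, Or.inr rfl⟩
  have h0 : (0 : Fin 3 → ℝ) ∈ octahedron := by
    have := hc (hp 0) (hm 0) (a := 1 / 2) (b := 1 / 2) (by norm_num) (by norm_num) (by norm_num)
    simpa using this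
  -- y = ∑ |yᵢ| (± eᵢ) + (1 - ∑ |yᵢ|) · 0: the index `none` carries the leftover weight at the
  -- origin.
  let w : Option (Fin 3) → ℝ := fun o => o.elim (1 - ∑ i, |y i|) fun i => |y i|
  let z : Option (Fin 3) → Fin 3 → ℝ := fun o => o.elim 0 fun i =>
    if 0 ≤ y i then Pi.single i 1 else -Pi.single i 1
  have h := hc.sum_mem (t := Finset.univ) (w := w) (z := z) ?_ ?_ ?_
  · convert h
    rw [Fintype.sum_option]
    ext j
    simp only [w, z, Option.elim, smul_zero, zero_add, Finset.sum_apply, Pi.smul_apply, smul_eq_mul]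
    rw [Finset.sum_eq_single j]
    · split_ifs with h
      · simp [abs_of_nonneg h]
      · simp [abs_of_neg (not_le.1 h)]
    · intro i _ hij
      split_ifs <;> simp [hij.symm]
    · simp
  · rintro (_ | i) _
    · simpa [w] using hy
    · exact abs_nonneg _
  · rw [Fintype.sum_option]; simp [w]
  · rintro (_ | i) _
    · exact h0
    · change (if 0 ≤ y i then Pi.single i 1 else -Pi.single i 1) ∈ octahedron
      split_ifs
      exacts [hp i, hm i]

theorem octahedron_eq_polar_cube : octahedron = polar cube :=
  Set.Subset.antisymm octahedron_subset_polar_cube fun _ hy =>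
    mem_octahedron_of_sum_abs_le_one (sum_abs_le_one_of_mem_polar_cube hy)

theorem mem_octahedron_iff (y : Fin 3 → ℝ) : y ∈ octahedron ↔ ∑ i, |y i| ≤ 1 :=
  ⟨fun h => sum_abs_le_one_of_mem_polar_cube (octahedron_subset_polar_cube h),
    mem_octahedron_of_sum_abs_le_one⟩

theorem mem_octahedron_of_mem_orbit {u v : Fin 3 → ℝ}
    (hv : v ∈ MulAction.orbit tetrahedralGroup u) (hu : u ∈ octahedron) : v ∈ octahedron := by
  obtain ⟨π, ε, hε, rfl⟩ := mem_orbit_iff.1 hv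
  rw [mem_octahedron_iff] at hu ⊢
  simp only [abs_units_mul]
  rwa [Equiv.sum_comp π fun i => |u i|]

theorem cube_eq_polar_octahedron : cube = polar octahedron := by
  refine Set.Subset.antisymm (fun x hx y hy => ?_) fun x hx i => ?_
  · rw [dotProduct_comm]
    exact octahedron_subset_polar_cube hy x hx
  · have h1 := hx _ (subset_convexHull ℝ _ ⟨i, Or.inl rfl⟩)
    have h2 := hx _ (subset_convexHull ℝ _ ⟨i, Or.inr rfl⟩)
    simp at h1 h2
    exact abs_le.2 ⟨by linarith, by linarith⟩

theorem mem_tetrahedron_iff_four (x : Fin 3 → ℝ) : x ∈ tetrahedron ↔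
    0 ≤ 1 + x 0 + x 1 - x 2 ∧ 0 ≤ 1 + x 0 - x 1 + x 2 ∧ 0 ≤ 1 - x 0 + x 1 + x 2 ∧
      0 ≤ 1 - x 0 - x 1 - x 2 := by
  constructor
  · intro h
    have h1 := h 1 1
    have h2 := h 1 (-1)
    have h3 := h (-1) 1
    have h4 := h (-1) (-1)
    norm_num at h1 h2 h3 h4
    exact ⟨by linarith, by linarith, by linarith, by linarith⟩
  · rintro ⟨h1, h2, h3, h4⟩ a b
    rcases Int.units_eq_one_or a with rfl | rfl <;> rcases Int.units_eq_one_or b with rfl | rfl <;>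
      norm_num <;> linarith

theorem convexHull_subset_tetrahedron :
    convexHull ℝ {![1, 1, -1], ![1, -1, 1], ![-1, 1, 1], ![-1, -1, -1]} ⊆ tetrahedron := by
  refine convexHull_min ?_ ?_
  · rintro x (rfl | rfl | rfl | rfl) <;> rw [mem_tetrahedron_iff_four] <;>
      simp only [Matrix.cons_val] <;> norm_num
  · intro a ha b hb s t hs ht hst x y
    have h1 := mul_nonneg hs (ha x y)
    have h2 := mul_nonneg ht (hb x y)
    simp only [Pi.add_apply, Pi.smul_apply, smul_eq_mul]
    nlinarith

theorem tetrahedron_eq_convexHull :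
    tetrahedron = convexHull ℝ {![1, 1, -1], ![1, -1, 1], ![-1, 1, 1], ![-1, -1, -1]} := by
  refine Set.Subset.antisymm (fun x hx => ?_) convexHull_subset_tetrahedron
  obtain ⟨h1, h2, h3, h4⟩ := (mem_tetrahedron_iff_four x).1 hx
  have h := (convex_convexHull ℝ
    {![1, 1, -1], ![1, -1, 1], ![-1, 1, 1], (![-1, -1, -1] : Fin 3 → ℝ)}).sum_mem
    (t := (Finset.univ : Finset (Fin 4)))
    -- The barycentric coordinates of x are the four defining linear forms divided by 4.
    (w := ![(1 + x 0 + x 1 - x 2) / 4, (1 + x 0 - x 1 + x 2) / 4, (1 - x 0 + x 1 + x 2) / 4,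
      (1 - x 0 - x 1 - x 2) / 4])
    (z := ![![1, 1, -1], ![1, -1, 1], ![-1, 1, 1], ![-1, -1, -1]])
    (fun i _ => by fin_cases i <;> simp <;> linarith)
    (by simp [Fin.sum_univ_four]; ring)
    (fun i _ => subset_convexHull ℝ _ (by fin_cases i <;> simp))
  convert h
  ext i
  fin_cases i <;> simp [Fin.sum_univ_four] <;> ring

/-- Each defining inequality reads 0 ≤ 1 + v·x for one vertex v, so membership in the tetrahedron is
the polar condition tested on the vertices. -/
theorem tetrahedron_eq_polar : tetrahedron = polar tetrahedron := by
  have hv : ∀ x : Fin 3 → ℝ, x ∈ tetrahedron ↔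
      ∀ v ∈ ({![1, 1, -1], ![1, -1, 1], ![-1, 1, 1], ![-1, -1, -1]} : Set (Fin 3 → ℝ)),
        0 ≤ 1 + v ⬝ᵥ x := by
    intro x
    rw [mem_tetrahedron_iff_four]
    simp only [Set.mem_insert_iff, Set.mem_singleton_iff, forall_eq_or_imp, forall_eq, dotProduct,
      Fin.sum_univ_three, Matrix.cons_val]
    constructor <;> rintro ⟨h1, h2, h3, h4⟩ <;>
      exact ⟨by linarith, by linarith, by linarith, by linarith⟩
  refine Set.Subset.antisymm (fun y hy x hx => ?_) fun y hy => ?_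
  · rw [tetrahedron_eq_convexHull] at hx
    have hconv : Convex ℝ {x : Fin 3 → ℝ | 0 ≤ 1 + x ⬝ᵥ y} := by
      intro a ha b hb s t hs ht hst
      have h1 := mul_nonneg hs ha
      have h2 := mul_nonneg ht hb
      simp only [Set.mem_ofPred_eq, add_dotProduct, smul_dotProduct, smul_eq_mul]
      nlinarith
    exact convexHull_min ((hv y).1 hy) hconv hx
  · refine (hv y).2 fun v hvv => hy v ?_
    rw [tetrahedron_eq_convexHull]
    exact subset_convexHull ℝ _ hvv

/-- Every orbit has a representative with `v₀ ≥ v₁ ≥ |v₂|`. -/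
theorem exists_sorted_mem_orbit (u : Fin 3 → ℝ) :
    ∃ v ∈ MulAction.orbit tetrahedralGroup u, v 1 ≤ v 0 ∧ |v 2| ≤ v 1 := by
  let σ := Tuple.sort fun i => -|u i|
  have hm : Monotone ((fun i => -|u i|) ∘ σ) := Tuple.monotone_sort _
  have h01 : |u (σ 1)| ≤ |u (σ 0)| := by
    have := hm (show (0 : Fin 3) ≤ 1 by decide)
    simpa using this
  have h12 : |u (σ 2)| ≤ |u (σ 1)| := by
    have := hm (show (1 : Fin 3) ≤ 2 by decide)
    simpa using this
  have hs : ∀ a : ℝ, ∃ e : ℤˣ, ((e : ℤ) : ℝ) * a = |a| := by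
    intro a
    rcases le_total 0 a with h | h
    · exact ⟨1, by simp [abs_of_nonneg h]⟩
    · exact ⟨-1, by simp [abs_of_nonpos h]⟩
  obtain ⟨e0, h0⟩ := hs (u (σ 0))
  obtain ⟨e1, h1⟩ := hs (u (σ 1))
  -- The first two signs make their entries nonnegative; parity then forces the third, so the last
  -- entry may stay negative.
  refine ⟨_, mem_orbit_iff.2 ⟨σ, ![e0, e1, e0 * e1], ?_, rfl⟩, ?_, ?_⟩
  · rw [Fin.prod_univ_three]
    simp only [Matrix.cons_val]
    rw [Int.units_mul_self]
  · simpa [h0, h1] using h01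
  · rw [abs_units_mul]
    simpa [h1] using h12

/-! ### Operators in canonical form -/

theorem trace_pauli_mul_pauli (μ ν : Fin 4) :
    (pauli μ * pauli ν).trace = if μ = ν then 2 else 0 := by
  fin_cases μ <;> fin_cases ν <;> simp [pauli, Matrix.trace, Fin.sum_univ_two] <;> norm_num

theorem coeff_canonicalForm (d : Fin 4 → ℝ) : coeff (canonicalForm d) = Matrix.diagonal d := by
  ext μ ν
  simp only [coeff, canonicalForm, Finset.sum_mul, Matrix.smul_mul, ← Matrix.mul_kronecker_mul,
    Matrix.trace_sum, Matrix.trace_smul, Matrix.trace_kronecker, trace_pauli_mul_pauli, smul_eq_mul,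
    Complex.re_sum, Complex.re_ofReal_mul, Matrix.diagonal_apply]
  rw [Finset.sum_eq_single μ]
  · by_cases h : μ = ν
    · simp [h]
      norm_num
    · simp [h]
  · intro b _ hb
    simp [hb]
  · simp

theorem canonicalForm_isHermitian (d : Fin 4 → ℝ) : (canonicalForm d).IsHermitian := by
  simp [Matrix.IsHermitian, canonicalForm, Matrix.conjTranspose_sum, Matrix.conjTranspose_smul,
    Matrix.conjTranspose_kronecker, pauli_hermitian]

theorem canonicalForm_smul (r : ℝ) (d : Fin 4 → ℝ) :
    canonicalForm (r • d) = (r : ℂ) • canonicalForm d := by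
  simp only [canonicalForm, Finset.smul_sum, smul_smul, Pi.smul_apply, smul_eq_mul,
    Complex.ofReal_mul]

theorem canonicalForm_add (d e : Fin 4 → ℝ) :
    canonicalForm (d + e) = canonicalForm d + canonicalForm e := by
  simp [canonicalForm, add_smul, Finset.sum_add_distrib]

/-- The eigenvalues of `canonicalForm d` on the vectorized Pauli matrices. -/
def bellEigenvalue (d : Fin 4 → ℝ) : Fin 4 → ℝ :=
  ![d 0 + d 1 - d 2 + d 3, d 0 + d 1 + d 2 - d 3, d 0 - d 1 - d 2 - d 3, d 0 - d 1 + d 2 + d 3]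

/-- A ⊗ B acts on vectorized matrices by X ↦ A X Bᵀ, and σ^α σ^μ (σ^α)ᵀ = ± σ^μ. So the vectorized
Pauli matrices, which are the Bell vectors up to scale, are common eigenvectors. -/
theorem canonicalForm_mul_pauliVec (d : Fin 4 → ℝ) : canonicalForm d * pauliVec =
    pauliVec * Matrix.diagonal fun μ => ((bellEigenvalue d μ : ℝ) : ℂ) := by
  ext ⟨i, j⟩ μ
  rw [Matrix.mul_diagonal]
  simp only [canonicalForm, Matrix.mul_apply, Fintype.sum_prod_type, Fin.sum_univ_two,
    Fin.sum_univ_four, pauliVec]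
  fin_cases i <;> fin_cases j <;> fin_cases μ <;> simp [pauli, bellEigenvalue] <;> ring

theorem canonicalForm_eq (d : Fin 4 → ℝ) : canonicalForm d =
    pauliVec * (Matrix.diagonal fun μ => ((bellEigenvalue d μ : ℝ) : ℂ)) *
      ((1 / 2 : ℂ) • pauliVecᴴ) := by
  rw [← canonicalForm_mul_pauliVec, Matrix.mul_assoc, pauliVec_mul_conjTranspose, Matrix.mul_one]

theorem charpoly_canonicalForm (d : Fin 4 → ℝ) :
    (canonicalForm d).charpoly = ∏ ε₁ : ℤˣ, ∏ ε₂ : ℤˣ,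
      (Polynomial.X - Polynomial.C (((d 0 + ((ε₁ : ℤ) : ℝ) * d 1 + ((ε₂ : ℤ) : ℝ) * d 2
        - ((ε₁ : ℤ) : ℝ) * ((ε₂ : ℤ) : ℝ) * d 3 : ℝ) : ℂ))) := by
  have h : (canonicalForm d).charpoly =
      (Matrix.diagonal fun μ => ((bellEigenvalue d μ : ℝ) : ℂ)).charpoly := by
    rw [canonicalForm_eq, Matrix.mul_assoc, Matrix.charpoly_mul_comm_of_le _ _ (by simp),
      Matrix.mul_assoc, conjTranspose_pauliVec_mul]
    simp
  rw [h, Matrix.charpoly_diagonal, Fin.prod_univ_four]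
  have hu : (Finset.univ : Finset ℤˣ) = {1, -1} := rfl
  have hn : (1 : ℤˣ) ∉ ({-1} : Finset ℤˣ) := by decide
  simp only [hu, Finset.prod_insert hn, Finset.prod_singleton, bellEigenvalue, Matrix.cons_val]
  simp only [Units.val_one, Units.val_neg, Int.cast_one, Int.cast_neg, one_mul, neg_mul, sub_neg_eq_add,
    mul_neg, mul_one, neg_neg, ← sub_eq_add_neg]
  ring

theorem isState_canonicalForm_iff (d : Fin 4 → ℝ) :
    IsState (canonicalForm d) ↔ ∀ μ, 0 ≤ bellEigenvalue d μ := by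
  have hd : (Matrix.diagonal fun μ => ((bellEigenvalue d μ : ℝ) : ℂ)).PosSemidef ↔
      ∀ μ, 0 ≤ bellEigenvalue d μ := by
    simp [Matrix.posSemidef_diagonal_iff]
  rw [← hd]
  have h2 : (0 : ℂ) ≤ 1 / 2 := by
    rw [show (1 / 2 : ℂ) = ((1 / 2 : ℝ) : ℂ) by simp]
    exact Complex.zero_le_real.2 (by norm_num)
  constructor
  · intro h
    have h1 := (h.conjTranspose_mul_mul_same pauliVec).smul h2
    rwa [Matrix.mul_assoc, canonicalForm_mul_pauliVec, ← Matrix.smul_mul, ← Matrix.mul_assoc,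
      conjTranspose_pauliVec_mul, Matrix.one_mul] at h1
  · intro h
    rw [IsState, canonicalForm_eq, Matrix.mul_smul]
    exact (h.mul_mul_conjTranspose_same pauliVec).smul h2

theorem isState_normalForm_iff (u : Fin 3 → ℝ) : IsState (normalForm u) ↔ u ∈ tetrahedron := by
  rw [normalForm, isState_canonicalForm_iff, mem_tetrahedron_iff_four]
  simp only [Fin.forall_fin_succ, bellEigenvalue]
  simp
  constructor <;> rintro ⟨h1, h2, h3, h4⟩ <;>
    exact ⟨by linarith, by linarith, by linarith, by linarith⟩

theorem dotProduct_coeff_normalForm (u : Fin 3 → ℝ) (x y : Fin 4 → ℝ) :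
    x ⬝ᵥ coeff (normalForm u) *ᵥ y = x 0 * y 0 + (x 1 * u 0 * y 1 + x 2 * u 1 * y 2
      + x 3 * u 2 * y 3) := by
  rw [normalForm, coeff_canonicalForm]
  simp [Matrix.mulVec_diagonal, dotProduct, Fin.sum_univ_four]
  ring

/-- Cauchy–Schwarz for the spatial parts. The bound m = 1 yields potential witnesses, and a common
bound m < 1 yields strict ones. -/
theorem abs_sum_mul_le {u : Fin 3 → ℝ} {m : ℝ} (hu : ∀ i, |u i| ≤ m) {x y : Fin 4 → ℝ}
    (hx : x ∈ lightCone) (hy : y ∈ lightCone) :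
    |x 1 * u 0 * y 1 + x 2 * u 1 * y 2 + x 3 * u 2 * y 3| ≤ m * (x 0 * y 0) := by
  have hm : 0 ≤ m := (abs_nonneg _).trans (hu 0)
  have h0 : 0 ≤ x 0 * y 0 := mul_nonneg hx.1 hy.1
  have hsq : (|x 1| * |y 1| + |x 2| * |y 2| + |x 3| * |y 3|) ^ 2 ≤ (x 0 * y 0) ^ 2 := by
    have h1 := mul_le_mul hx.2 hy.2 (by positivity) (by positivity)
    rw [← sq_abs (x 1), ← sq_abs (x 2), ← sq_abs (x 3), ← sq_abs (y 1), ← sq_abs (y 2),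
      ← sq_abs (y 3)] at h1
    -- The squares are those of Lagrange's identity.
    nlinarith [sq_nonneg (|x 1| * |y 2| - |x 2| * |y 1|), sq_nonneg (|x 1| * |y 3| - |x 3| * |y 1|),
      sq_nonneg (|x 2| * |y 3| - |x 3| * |y 2|)]
  have hle := abs_le_of_sq_le_sq' hsq h0
  have hterm : ∀ (a b : ℝ) (i : Fin 3), |a * u i * b| ≤ m * (|a| * |b|) := by
    intro a b i
    rw [abs_mul, abs_mul]
    nlinarith [mul_le_mul_of_nonneg_right (hu i) (mul_nonneg (abs_nonneg a) (abs_nonneg b))]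
  calc _ ≤ |x 1 * u 0 * y 1| + |x 2 * u 1 * y 2| + |x 3 * u 2 * y 3| := abs_add_three _ _ _
    _ ≤ m * (|x 1| * |y 1|) + m * (|x 2| * |y 2|) + m * (|x 3| * |y 3|) :=
        add_le_add (add_le_add (hterm _ _ _) (hterm _ _ _)) (hterm _ _ _)
    _ = m * (|x 1| * |y 1| + |x 2| * |y 2| + |x 3| * |y 3|) := by ring
    _ ≤ _ := mul_le_mul_of_nonneg_left hle.2 hm

/-- Light-like vectors along the i-th axis; the signs e = ±1 make |uᵢ| ≤ 1, or |uᵢ| < 1, a necessary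
condition. -/
theorem exists_lightCone_pairing (u : Fin 3 → ℝ) (i : Fin 3) {e : ℝ} (he : e ^ 2 = 1) :
    ∃ x ∈ lightCone, ∃ y ∈ lightCone, x ≠ 0 ∧ y ≠ 0 ∧
      x ⬝ᵥ coeff (normalForm u) *ᵥ y = 1 + e * u i := by
  have hne : ∀ v : Fin 3 → ℝ, (Matrix.vecCons 1 v : Fin 4 → ℝ) ≠ 0 := fun v h => by
    simpa using congrFun h 0
  simp only [dotProduct_coeff_normalForm]
  fin_cases i
  · exact ⟨![1, 1, 0, 0], by simp [lightCone], ![1, e, 0, 0], by simp [lightCone, he],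
      hne _, hne _, by simp; ring⟩
  · exact ⟨![1, 0, 1, 0], by simp [lightCone], ![1, 0, e, 0], by simp [lightCone, he],
      hne _, hne _, by simp; ring⟩
  · exact ⟨![1, 0, 0, 1], by simp [lightCone], ![1, 0, 0, e], by simp [lightCone, he],
      hne _, hne _, by simp; ring⟩

theorem isPotentialWitness_normalForm_iff (u : Fin 3 → ℝ) :
    IsPotentialWitness (normalForm u) ↔ u ∈ cube := by
  rw [isPotentialWitness_iff]
  constructor
  · rintro ⟨-, h⟩ i
    have key : ∀ e : ℝ, e ^ 2 = 1 → 0 ≤ 1 + e * u i := by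
      intro e he
      obtain ⟨x, hx, y, hy, -, -, h1⟩ := exists_lightCone_pairing u i he
      exact h1 ▸ h x hx y hy
    have h1 := key 1 (by norm_num)
    have h2 := key (-1) (by norm_num)
    exact abs_le.2 ⟨by linarith, by linarith⟩
  · intro hu
    refine ⟨canonicalForm_isHermitian _, fun x hx y hy => ?_⟩
    rw [dotProduct_coeff_normalForm]
    have := abs_le.1 (abs_sum_mul_le hu hx hy)
    linarith

theorem isStrictWitness_normalForm {u : Fin 3 → ℝ} (hu : u ∈ openCube) :
    IsStrictWitness (normalForm u) := by
  rw [isStrictWitness_iff]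
  refine ⟨canonicalForm_isHermitian _, fun x hx y hy hx0 hy0 => ?_⟩
  rw [dotProduct_coeff_normalForm]
  obtain ⟨m, hm1, hm⟩ : ∃ m < 1, ∀ i, |u i| ≤ m :=
    ⟨max |u 0| (max |u 1| |u 2|), by simp [hu 0, hu 1, hu 2], fun i => by fin_cases i <;> simp⟩
  have h1 := abs_le.1 (abs_sum_mul_le hm hx hy)
  have h2 := mul_pos (lightCone_zero_pos hx hx0) (lightCone_zero_pos hy hy0)
  nlinarith

theorem IsStrictWitness.mem_openCube {u : Fin 3 → ℝ} (h : IsStrictWitness (normalForm u)) :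
    u ∈ openCube := by
  rw [isStrictWitness_iff] at h
  intro i
  have key : ∀ e : ℝ, e ^ 2 = 1 → 0 < 1 + e * u i := by
    intro e he
    obtain ⟨x, hx, y, hy, hx0, hy0, h1⟩ := exists_lightCone_pairing u i he
    exact h1 ▸ h.2 x hx y hy hx0 hy0
  have h1 := key 1 (by norm_num)
  have h2 := key (-1) (by norm_num)
  exact abs_lt.2 ⟨by linarith, by linarith⟩

/-! ### Separable operators in normal form -/

theorem normalForm_convexComb (u v : Fin 3 → ℝ) {s t : ℝ} (h : s + t = 1) :
    normalForm (s • u + t • v) = (s : ℂ) • normalForm u + (t : ℂ) • normalForm v := by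
  rw [normalForm, normalForm, normalForm, ← canonicalForm_smul, ← canonicalForm_smul,
    ← canonicalForm_add]
  congr 1
  ext μ
  refine Fin.cases ?_ (fun i => ?_) μ <;> simp [h]

theorem isSeparable_normalForm_single (i : Fin 3) {e : ℝ} (he : e ^ 2 = 1) :
    IsSeparable (normalForm (Pi.single i e)) := by
  have hp : ∀ f : ℝ, f ^ 2 = 1 → (1 + (f : ℂ) • pauli i.succ : Op1).PosSemidef := by
    intro f hf
    have h : (1 + (f : ℂ) • pauli i.succ : Op1) =
        bloch (Pi.single 0 1 + f • Pi.single i.succ 1) := by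
      rw [bloch_add, ← pauli_eq_bloch]
      congr 1
      rw [pauli_eq_bloch, bloch, bloch, Finset.smul_sum]
      simp only [smul_smul, Pi.smul_apply, smul_eq_mul, Complex.ofReal_mul]
    rw [h, bloch_posSemidef_iff]
    fin_cases i <;> simp [lightCone, hf]
  have h1 : normalForm (Pi.single i e) = 1 + (e : ℂ) • (pauli i.succ ⊗ₖ pauli i.succ) := by
    rw [normalForm, canonicalForm, Fin.sum_univ_succ, Finset.sum_eq_single i]
    · simp [pauli]
    · intro j _ hj
      simp [hj]
    · simp
  -- 1 + e σ⊗σ averages (1 + σ) ⊗ (1 + eσ) and (1 - σ) ⊗ (1 - eσ), since the terms linear in σ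
  -- cancel.
  have h2 : normalForm (Pi.single i e) =
      ((1 / 2 : ℝ) : ℂ) • ((1 + ((1 : ℝ) : ℂ) • pauli i.succ) ⊗ₖ (1 + (e : ℂ) • pauli i.succ)) +
      ((1 / 2 : ℝ) : ℂ) • ((1 + ((-1 : ℝ) : ℂ) • pauli i.succ) ⊗ₖ
        (1 + ((-e : ℝ) : ℂ) • pauli i.succ)) := by
    rw [h1]
    simp only [Matrix.add_kronecker, Matrix.kronecker_add, Matrix.smul_kronecker,
      Matrix.kronecker_smul, Matrix.one_kronecker_one]
    push_cast
    module
  rw [h2]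
  exact ((isSeparable_kronecker (hp 1 (by norm_num)) (hp e he)).smul (by norm_num)).add
    ((isSeparable_kronecker (hp (-1) (by norm_num)) (hp (-e) (by simpa using he))).smul
      (by norm_num))

/-- Normal forms with x in the cube are witnesses, and their pairing 4 (1 + x·u) with a separable
one puts u in the polar of the cube. Conversely, convexity reduces to the vertices ± eᵢ. -/
theorem isSeparable_normalForm_iff (u : Fin 3 → ℝ) :
    IsSeparable (normalForm u) ↔ u ∈ octahedron := by
  constructor
  · intro h
    rw [octahedron_eq_polar_cube]
    intro x hx
    have h1 := ((isPotentialWitness_normalForm_iff x).2 hx).2 _ h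
    have h2 : (Matrix.trace (normalForm x * normalForm u)).re = 4 * (1 + x ⬝ᵥ u) := by
      simp only [normalForm, canonicalForm, Finset.sum_mul, Finset.mul_sum, Matrix.smul_mul,
        Matrix.mul_smul, ← Matrix.mul_kronecker_mul, Matrix.trace_sum, Matrix.trace_smul,
        Matrix.trace_kronecker, trace_pauli_mul_pauli]
      simp [Fin.sum_univ_four, dotProduct, Fin.sum_univ_three]
      ring
    rw [h2] at h1
    linarith
  · have hc : Convex ℝ {u | IsSeparable (normalForm u)} := by
      intro u hu v hv s t hs ht hst
      change IsSeparable _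
      rw [normalForm_convexComb u v hst]
      exact (IsSeparable.smul hu hs).add (IsSeparable.smul hv ht)
    refine fun hu => convexHull_min ?_ hc hu
    rintro x ⟨i, rfl | rfl⟩
    · exact isSeparable_normalForm_single i (by norm_num)
    · rw [← Pi.single_neg]
      exact isSeparable_normalForm_single i (by norm_num)

/-! ### Tetrahedral symmetries are local operations -/

theorem conjLocal_canonicalForm (A B : Op1) (d : Fin 4 → ℝ) : conjLocal A B (canonicalForm d) =
    ∑ α, ((d α : ℝ) : ℂ) • ((A * pauli α * Aᴴ) ⊗ₖ (B * pauli α * Bᴴ)) := by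
  simp only [canonicalForm, conjLocal_sum, conjLocal_smul, conjLocal_kronecker]

/-- Conjugating one qubit by σᵏ fixes σ⁰ and σᵏ and negates the other two Pauli matrices. -/
theorem stateEquiv_flip (k : Fin 3) (u : Fin 3 → ℝ) :
    StateEquiv (normalForm u) (normalForm fun i => if i = k then u i else -u i) := by
  have h : normalForm (fun i => if i = k then u i else -u i) =
      ((1 : ℝ) : ℂ) • conjLocal (pauli k.succ) 1 (normalForm u) := by
    have hs : ∀ α, pauli k.succ * pauli α * (pauli k.succ)ᴴ =
        (if α = 0 ∨ α = k.succ then (1 : ℂ) else -1) • pauli α := by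
      intro α
      rw [pauli_hermitian]
      fin_cases k <;> fin_cases α <;> ext i j <;> fin_cases i <;> fin_cases j <;>
        simp [pauli]
    rw [normalForm, normalForm, conjLocal_canonicalForm, canonicalForm, Complex.ofReal_one,
      one_smul]
    refine Finset.sum_congr rfl fun α _ => ?_
    rw [hs, Matrix.smul_kronecker, smul_smul, Matrix.one_mul, Matrix.conjTranspose_one,
      Matrix.mul_one]
    congr 1
    refine Fin.cases ?_ (fun i => ?_) α
    · simp
    · by_cases hi : i = k <;> simp [hi, Fin.succ_ne_zero]
  rw [h]
  refine stateEquiv_smul_conjLocal _ ?_ (by simp) one_pos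
  fin_cases k <;> simp [pauli]

/-- Up to scale this is the rotation by π about the bisector of axes i and j: it swaps these axes
and reverses the third. -/
theorem pauli_add_pauli_conj {i j : Fin 3} (hij : i ≠ j) (α : Fin 4) :
    (pauli i.succ + pauli j.succ) * pauli α * (pauli i.succ + pauli j.succ)ᴴ =
      (if α = 0 ∨ α = i.succ ∨ α = j.succ then (2 : ℂ) else -2) •
        pauli (Equiv.swap i.succ j.succ α) := by
  rw [Matrix.conjTranspose_add, pauli_hermitian, pauli_hermitian]
  fin_cases i <;> fin_cases j <;> first | exact absurd rfl hij | skip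
  all_goals
    fin_cases α <;> ext k l <;> fin_cases k <;> fin_cases l <;>
      simp [pauli, Equiv.swap_apply_def, Matrix.mul_apply, Fin.sum_univ_two] <;> ring_nf <;>
      norm_num [Complex.I_sq] <;> ring

theorem det_pauli_add_pauli {i j : Fin 3} (hij : i ≠ j) :
    (pauli i.succ + pauli j.succ).det ≠ 0 := by
  fin_cases i <;> fin_cases j <;> first | exact absurd rfl hij | skip
  all_goals
    simp [pauli, Matrix.det_fin_two, Complex.ext_iff] <;> norm_num

theorem stateEquiv_swap {i j : Fin 3} (hij : i ≠ j) (u : Fin 3 → ℝ) :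
    StateEquiv (normalForm u) (normalForm fun k => u (Equiv.swap i j k)) := by
  -- With the same rotation on both qubits the reversed third axis contributes (-2)² = 4, like the
  -- factor 2² of the others; 1/4 compensates.
  have h : normalForm (fun k => u (Equiv.swap i j k)) = ((1 / 4 : ℝ) : ℂ) •
      conjLocal (pauli i.succ + pauli j.succ) (pauli i.succ + pauli j.succ) (normalForm u) := by
    rw [normalForm, normalForm, conjLocal_canonicalForm, canonicalForm,
      ← Equiv.sum_comp (Equiv.swap i.succ j.succ), Finset.smul_sum]
    refine Finset.sum_congr rfl fun α _ => ?_
    rw [pauli_add_pauli_conj hij, Matrix.smul_kronecker, Matrix.kronecker_smul, smul_smul,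
      smul_smul, smul_smul]
    congr 1
    have h1 : (Matrix.vecCons 1 (fun k => u (Equiv.swap i j k)) : Fin 4 → ℝ)
        (Equiv.swap i.succ j.succ α) = (Matrix.vecCons 1 u : Fin 4 → ℝ) α := by
      refine Fin.cases ?_ (fun k => ?_) α
      · rw [Equiv.swap_apply_of_ne_of_ne (Fin.succ_ne_zero i).symm (Fin.succ_ne_zero j).symm]
        rfl
      · rw [(Fin.succ_injective 3).swap_apply, Matrix.cons_val_succ, Equiv.swap_apply_self,
          Matrix.cons_val_succ]
    rw [h1]
    split_ifs <;> push_cast <;> ring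
  rw [h]
  exact stateEquiv_smul_conjLocal _ (det_pauli_add_pauli hij) (det_pauli_add_pauli hij)
    (by norm_num)

theorem stateEquiv_signs {ε : Fin 3 → ℤˣ} (hε : ∏ i, ε i = 1) (w : Fin 3 → ℝ) :
    StateEquiv (normalForm w) (normalForm fun i => ((ε i : ℤ) : ℝ) * w i) := by
  have hw : ∀ k, (fun i => if i = k then w i else -w i) = (fun i => ((ε i : ℤ) : ℝ) * w i) →
      StateEquiv (normalForm w) (normalForm fun i => ((ε i : ℤ) : ℝ) * w i) :=
    fun k hk => hk ▸ stateEquiv_flip k w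
  have h2 : ε 2 = ε 0 * ε 1 := by
    rw [Fin.prod_univ_three] at hε
    rw [← mul_one (ε 0 * ε 1), ← Int.units_mul_self (ε 2), ← mul_assoc, hε, one_mul]
  rcases Int.units_eq_one_or (ε 0) with h0 | h0 <;> rcases Int.units_eq_one_or (ε 1) with h1 | h1 <;>
    rw [h0, h1] at h2
  · have : (fun i => ((ε i : ℤ) : ℝ) * w i) = w := by
      ext i; fin_cases i <;> simp [h0, h1, h2]
    rw [this]
    exact stateEquiv_refl _
  · exact hw 0 (by ext i; fin_cases i <;> simp [h0, h1, h2])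
  · exact hw 1 (by ext i; fin_cases i <;> simp [h0, h1, h2])
  · exact hw 2 (by ext i; fin_cases i <;> simp [h0, h1, h2])

theorem stateEquiv_of_mem_orbit {u v : Fin 3 → ℝ}
    (h : v ∈ MulAction.orbit tetrahedralGroup u) : StateEquiv (normalForm u) (normalForm v) := by
  obtain ⟨π, ε, hε, rfl⟩ := mem_orbit_iff.1 h
  have hperm : ∀ (π : Equiv.Perm (Fin 3)) (u : Fin 3 → ℝ),
      StateEquiv (normalForm u) (normalForm fun k => u (π k)) := by
    intro π
    induction π using Equiv.Perm.swap_induction_on with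
    | one => exact fun u => stateEquiv_refl _
    | swap_mul f i j hij ih =>
      exact fun u => (stateEquiv_swap hij u).trans (ih fun k => u (Equiv.swap i j k))
  exact (hperm π u).trans (stateEquiv_signs hε _)

/-! ### Diagonalization of strict witnesses -/

theorem isCompact_lightCone_base : IsCompact {x : Fin 4 → ℝ | x ∈ lightCone ∧ x 0 = 1} := by
  refine (isCompact_Icc (a := fun _ : Fin 4 => (-1 : ℝ)) (b := fun _ => 1)).of_isClosed_subset
    ?_ ?_
  · refine IsClosed.inter (IsClosed.inter ?_ ?_) ?_
    · exact isClosed_le continuous_const (continuous_apply 0)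
    · exact isClosed_le (f := fun x : Fin 4 → ℝ => x 1 ^ 2 + x 2 ^ 2 + x 3 ^ 2)
        (g := fun x => x 0 ^ 2) (by fun_prop) (by fun_prop)
    · exact isClosed_eq (continuous_apply 0) continuous_const
  · rintro x ⟨⟨-, h⟩, h0⟩
    rw [h0] at h
    rw [Set.mem_Icc, Pi.le_def, Pi.le_def, ← forall_and]
    intro μ
    rw [← abs_le, ← sq_le_one_iff_abs_le_one]
    have h1 : ∀ μ, x μ ^ 2 ≤ 1 := by
      simp only [Fin.forall_fin_succ, Fin.succ_zero_eq_one, Fin.succ_one_eq_two, h0,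
        show Fin.succ (2 : Fin 3) = 3 from rfl]
      refine ⟨by norm_num, ?_, ?_, ?_, fun i => i.elim0⟩ <;>
        nlinarith [sq_nonneg (x 1), sq_nonneg (x 2), sq_nonneg (x 3)]
    exact h1 μ

theorem smul_mem_lightCone {x : Fin 4 → ℝ} (hx : x ∈ lightCone) {r : ℝ} (hr : 0 ≤ r) :
    r • x ∈ lightCone := by
  refine ⟨mul_nonneg hr hx.1, ?_⟩
  have := mul_le_mul_of_nonneg_left hx.2 (sq_nonneg r)
  simp only [Pi.smul_apply, smul_eq_mul]
  nlinarith

/-- The bilinear form attains a positive minimum on the compact base x₀ = y₀ = 1 of the product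
cone; homogeneity does the rest. -/
theorem IsStrictWitness.exists_lower_bound {W : Op2} (hW : IsStrictWitness W) :
    ∃ c > 0, ∀ x ∈ lightCone, ∀ y ∈ lightCone, c * (x 0 * y 0) ≤ x ⬝ᵥ coeff W *ᵥ y := by
  have h := ((isStrictWitness_iff W).1 hW).2
  have he : (Pi.single 0 1 : Fin 4 → ℝ) ∈ {x : Fin 4 → ℝ | x ∈ lightCone ∧ x 0 = 1} := by
    simp [lightCone]
  have hcont : Continuous fun p : (Fin 4 → ℝ) × (Fin 4 → ℝ) => p.1 ⬝ᵥ coeff W *ᵥ p.2 := by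
    simp only [dotProduct, Matrix.mulVec]
    fun_prop
  obtain ⟨⟨x₀, y₀⟩, ⟨⟨hx₀, hx₁⟩, hy₀, hy₁⟩, hmin⟩ :=
    (isCompact_lightCone_base.prod isCompact_lightCone_base).exists_isMinOn
      ⟨(_, _), he, he⟩ hcont.continuousOn
  refine ⟨x₀ ⬝ᵥ coeff W *ᵥ y₀, h x₀ hx₀ y₀ hy₀ ?_ ?_, fun x hx y hy => ?_⟩
  · rintro rfl; simp at hx₁
  · rintro rfl; simp at hy₁
  by_cases hx0 : x = 0
  · simp [hx0]
  by_cases hy0 : y = 0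
  · simp [hy0]
  have hxp := lightCone_zero_pos hx hx0
  have hyp := lightCone_zero_pos hy hy0
  have h1 : ((x 0)⁻¹ • x, (y 0)⁻¹ • y) ∈ {x : Fin 4 → ℝ | x ∈ lightCone ∧ x 0 = 1} ×ˢ
      {x : Fin 4 → ℝ | x ∈ lightCone ∧ x 0 = 1} :=
    ⟨⟨smul_mem_lightCone hx (by positivity), by simp [hxp.ne']⟩,
      ⟨smul_mem_lightCone hy (by positivity), by simp [hyp.ne']⟩⟩
  have h2 := hmin h1
  simp only [Set.mem_ofPred_eq, Matrix.mulVec_smul, dotProduct_smul, smul_dotProduct, smul_eq_mul]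
    at h2
  have h3 := mul_le_mul_of_nonneg_right h2 (mul_pos hxp hyp).le
  refine h3.trans_eq ?_
  field_simp

/-- det(A A†) = 1 gives x₀² ≥ 1, and Tr(A A†) = 2 x₀ is the sum of all |Aᵢⱼ|². Large entries thus
force a large x₀. -/
theorem exists_bloch_mul_conjTranspose {A : Op1} (hA : A.det = 1) :
    ∃ x ∈ lightCone, A * Aᴴ = bloch x ∧ 1 ≤ x 0 ∧ ∀ i j, ‖A i j‖ ^ 2 ≤ 2 * x 0 := by
  obtain ⟨x, hx, h⟩ := exists_bloch_of_posSemidef (Matrix.posSemidef_self_mul_conjTranspose A)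
  refine ⟨x, hx, h, ?_, ?_⟩
  · have h1 := congrArg Matrix.det h
    rw [Matrix.det_mul, Matrix.det_conjTranspose, hA, det_bloch, star_one, one_mul] at h1
    have h2 : (1 : ℝ) = x 0 ^ 2 - (x 1 ^ 2 + x 2 ^ 2 + x 3 ^ 2) := by exact_mod_cast h1
    have := hx.1
    nlinarith [sq_nonneg (x 1), sq_nonneg (x 2), sq_nonneg (x 3)]
  · have h1 := congrArg Complex.re (congrArg Matrix.trace h)
    rw [trace_bloch, Complex.ofReal_re] at h1
    have h2 : (A * Aᴴ).trace.re = ∑ i, ∑ j, ‖A i j‖ ^ 2 := by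
      simp only [Matrix.trace, Matrix.diag, Matrix.mul_apply, Matrix.conjTranspose_apply,
        Complex.re_sum, Complex.star_def, Complex.mul_conj, Complex.normSq_eq_norm_sq,
        Complex.ofReal_re]
    intro i j
    rw [← h1, h2]
    exact (Finset.single_le_sum (f := fun j => ‖A i j‖ ^ 2) (fun _ _ => by positivity)
      (Finset.mem_univ j)).trans (Finset.single_le_sum (f := fun i => ∑ j, ‖A i j‖ ^ 2)
        (fun _ _ => by positivity) (Finset.mem_univ i))

theorem isCompact_det_eq_one_norm_le (R : ℝ) :
    IsCompact {A : Op1 | A.det = 1 ∧ ∀ i j, ‖A i j‖ ≤ R} := by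
  have h : IsCompact {A : Op1 | ∀ i j, ‖A i j‖ ≤ R} := by
    have := isCompact_univ_pi fun _ : Fin 2 => isCompact_univ_pi fun _ : Fin 2 =>
      isCompact_closedBall (0 : ℂ) R
    convert! this using 1
    ext A
    exact ⟨fun h i _ j _ => mem_closedBall_zero_iff.2 (h i j),
      fun h i j => mem_closedBall_zero_iff.1 (h i trivial j trivial)⟩
  exact h.inter_left (isClosed_eq (continuous_id.matrix_det) continuous_const)

theorem continuous_conjLocal (W : Op2) :
    Continuous fun p : Op1 × Op1 => conjLocal p.1 p.2 W := by
  have h : Continuous fun p : Op1 × Op1 => p.1 ⊗ₖ p.2 :=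
    continuous_matrix fun i j => ((continuous_fst.matrix_elem _ _).mul
      (continuous_snd.matrix_elem _ _))
  exact (h.matrix_mul continuous_const).matrix_mul h.matrix_conjTranspose

/-- A separable state with distinct Lorentz singular values in the interior of the separable cone. -/
def referenceState : Op2 := canonicalForm ![7, 3, 2, 1]

theorem referenceState_eq : ∃ ρ, IsSeparable ρ ∧ referenceState = 1 + ρ := by
  -- Subtracting 1 leaves (6, 3, 2, 1), which is 6 times a normal form on the boundary of the
  -- octahedron: 1/2 + 1/3 + 1/6 = 1.
  refine ⟨((6 : ℝ) : ℂ) • normalForm ![1 / 2, 1 / 3, 1 / 6], IsSeparable.smul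
    ((isSeparable_normalForm_iff _).2 ((mem_octahedron_iff _).2 ?_)) (by norm_num), ?_⟩
  · rw [Fin.sum_univ_three]
    simp [abs_of_pos]
    norm_num
  · have h1 : (1 : Op2) = canonicalForm (Pi.single 0 1) := by
      rw [canonicalForm, Finset.sum_eq_single 0] <;> simp +contextual [pauli]
    rw [h1, normalForm, ← canonicalForm_smul, ← canonicalForm_add, referenceState]
    congr 1
    ext μ
    fin_cases μ <;> simp <;> norm_num

/-- The summand 1 of the reference state contributes Tr(W (AA† ⊗ BB†)) ≥ 4c x₀y₀, and the separable
rest contributes nothing negative. As x₀, y₀ ≥ 1, sublevel sets have bounded entries. -/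
theorem IsStrictWitness.exists_minimizer {W : Op2} (hW : IsStrictWitness W) :
    ∃ A B : Op1, A.det = 1 ∧ B.det = 1 ∧ ∀ A' B' : Op1, A'.det = 1 → B'.det = 1 →
      (Matrix.trace (W * conjLocal A B referenceState)).re ≤
        (Matrix.trace (W * conjLocal A' B' referenceState)).re := by
  set f : Op1 × Op1 → ℝ := fun p => (Matrix.trace (W * conjLocal p.1 p.2 referenceState)).re
    with hf
  have hcont : Continuous f :=
    Complex.continuous_re.comp
      ((continuous_const.matrix_mul (continuous_conjLocal _)).matrix_trace)
  obtain ⟨c, hc, hlow⟩ := hW.exists_lower_bound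
  obtain ⟨ρ, hρ, href⟩ := referenceState_eq
  have hbound : ∀ A B : Op1, A.det = 1 → B.det = 1 →
      (∀ i j, c * ‖A i j‖ ^ 2 ≤ f (A, B)) ∧ ∀ i j, c * ‖B i j‖ ^ 2 ≤ f (A, B) := by
    intro A B hA hB
    obtain ⟨x, hx, hxA, hx1, hx2⟩ := exists_bloch_mul_conjTranspose hA
    obtain ⟨y, hy, hyB, hy1, hy2⟩ := exists_bloch_mul_conjTranspose hB
    have h1 : 4 * (x ⬝ᵥ coeff W *ᵥ y) ≤ f (A, B) := by
      have h2 : conjLocal A B 1 = bloch x ⊗ₖ bloch y := by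
        rw [← Matrix.one_kronecker_one, conjLocal_kronecker, Matrix.mul_one, Matrix.mul_one,
          hxA, hyB]
      simp only [hf]
      rw [href, conjLocal_add, mul_add, Matrix.trace_add, Complex.add_re, h2,
        trace_mul_bloch_kronecker]
      exact le_add_of_nonneg_right (hW.isPotentialWitness.2 _ (hρ.conjLocal A B))
    have h3 := hlow x hx y hy
    have h4 : x 0 ≤ x 0 * y 0 := by nlinarith
    have h5 : y 0 ≤ x 0 * y 0 := by nlinarith
    have h6 : 0 ≤ x 0 * y 0 := by nlinarith
    constructor
    · intro i j
      nlinarith [hx2 i j, mul_le_mul_of_nonneg_left h4 hc.le, mul_nonneg hc.le h6,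
        mul_le_mul_of_nonneg_left (hx2 i j) hc.le]
    · intro i j
      nlinarith [hy2 i j, mul_le_mul_of_nonneg_left h5 hc.le, mul_nonneg hc.le h6,
        mul_le_mul_of_nonneg_left (hy2 i j) hc.le]
  set m := f (1, 1) with hm
  -- The estimate |z| ≤ |z|² + 1 gives a radius without square roots.
  have hR : ∀ z : ℂ, c * ‖z‖ ^ 2 ≤ m → ‖z‖ ≤ m / c + 1 := by
    intro z hz
    have : ‖z‖ ^ 2 ≤ m / c := by rw [le_div_iff₀ hc]; linarith
    nlinarith [sq_nonneg (‖z‖ - 1)]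
  have h1m : ∀ i j, ‖(1 : Op1) i j‖ ≤ m / c + 1 := fun i j =>
    hR _ ((hbound 1 1 (by simp) (by simp)).1 i j)
  have hK := (isCompact_det_eq_one_norm_le (m / c + 1)).prod
    (isCompact_det_eq_one_norm_le (m / c + 1))
  obtain ⟨⟨A, B⟩, ⟨⟨hA, -⟩, hB, -⟩, hmin⟩ := hK.exists_isMinOn
    ⟨(1, 1), ⟨by simp, h1m⟩, ⟨by simp, h1m⟩⟩ hcont.continuousOn
  refine ⟨A, B, hA, hB, fun A' B' hA' hB' => ?_⟩
  by_cases hle : f (A', B') ≤ m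
  · exact hmin (a := (A', B')) ⟨⟨hA', fun i j => hR _ (((hbound _ _ hA' hB').1 i j).trans hle)⟩,
      ⟨hB', fun i j => hR _ (((hbound _ _ hA' hB').2 i j).trans hle)⟩⟩
  · exact (hmin (a := (1, 1)) ⟨⟨by simp, h1m⟩, ⟨by simp, h1m⟩⟩).trans (not_le.1 hle).le

theorem eq_zero_of_quadratic_nonneg {p q : ℝ} (h : ∀ t : ℝ, 0 ≤ p * t + q * t ^ 2) : p = 0 := by
  -- At this t the value is p² (q - 1 - |q|) / (1 + |q|)², which is negative unless p = 0.
  have h1 := h (-p / (1 + |q|))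
  have hq : 0 < 1 + |q| := by positivity
  have h2 : p * (-p / (1 + |q|)) + q * (-p / (1 + |q|)) ^ 2 =
      p ^ 2 * (q - (1 + |q|)) / (1 + |q|) ^ 2 := by
    field_simp
    ring
  rw [h2] at h1
  have h3 : 0 ≤ p ^ 2 * (q - (1 + |q|)) := by
    have := mul_nonneg h1 (sq_nonneg (1 + |q|))
    rwa [div_mul_cancel₀ _ (by positivity)] at this
  have h4 := le_abs_self q
  by_contra hp
  have : 0 < p ^ 2 := by positivity
  nlinarith

/-- The difference is an exact quadratic polynomial in t. Hermiticity makes the two linear terms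
have equal real parts, so the derivative at 0 is twice the stated trace. -/
theorem re_trace_eq_zero_of_isMin {W S M : Op2} (hW : W.IsHermitian) (hS : S.IsHermitian)
    (h : ∀ t : ℝ, (W * S).trace.re ≤ (W * ((1 + (t : ℂ) • M) * S * (1 + (t : ℂ) • M)ᴴ)).trace.re) :
    (W * (M * S)).trace.re = 0 := by
  have h1 : (W * (S * Mᴴ)).trace.re = (W * (M * S)).trace.re := by
    have h2 : (W * (S * Mᴴ)).trace = star (W * (M * S)).trace := by
      rw [← Matrix.trace_conjTranspose, Matrix.conjTranspose_mul, Matrix.conjTranspose_mul, hW.eq,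
        hS.eq, Matrix.trace_mul_comm]
    rw [h2]
    simp
  have h3 : ∀ t : ℝ, 0 ≤ (2 * (W * (M * S)).trace.re) * t + (W * (M * S * Mᴴ)).trace.re * t ^ 2 := by
    intro t
    have h4 : W * ((1 + (t : ℂ) • M) * S * (1 + (t : ℂ) • M)ᴴ) = W * S +
        (t : ℂ) • (W * (M * S)) + (t : ℂ) • (W * (S * Mᴴ)) +
          ((t ^ 2 : ℝ) : ℂ) • (W * (M * S * Mᴴ)) := by
      simp only [Matrix.conjTranspose_add, Matrix.conjTranspose_one, Matrix.conjTranspose_smul,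
        Complex.star_def, Complex.conj_ofReal, add_mul, mul_add, one_mul, mul_one, smul_mul_assoc,
        mul_smul_comm, smul_add, smul_smul]
      push_cast
      rw [sq]
      abel
    have h5 := h t
    rw [h4] at h5
    simp only [Matrix.trace_add, Matrix.trace_smul, Complex.add_re, smul_eq_mul,
      Complex.re_ofReal_mul, h1] at h5
    nlinarith
  have := eq_zero_of_quadratic_nonneg h3
  linarith

/-- σʲ + e σᵏ has trace 0 and determinant -(1 + e²) = 0. Being nilpotent, it yields straight lines
inside SL(2, ℂ), so variations need no exponential. -/
theorem det_one_add_smul_pauli {j k : Fin 3} (hjk : j ≠ k) (s e : ℂ) (he : e ^ 2 = -1) :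
    (1 + s • (pauli j.succ + e • pauli k.succ)).det = 1 := by
  obtain ⟨z, hz⟩ : ∃ z, (1 + s • (pauli j.succ + e • pauli k.succ)).det = z := ⟨_, rfl⟩
  rw [hz]
  rw [← Complex.I_sq, sq_eq_sq_iff_eq_or_eq_neg] at he
  fin_cases j <;> fin_cases k <;> first | exact absurd rfl hjk | skip
  all_goals
    rcases he with rfl | rfl <;> simp [pauli, Matrix.det_fin_two] at hz <;> rw [← hz] <;>
      ring_nf <;> norm_num [Complex.I_sq]

/-- A real-linear first-order condition on nilpotent matrices extends to the Pauli matrices. -/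
theorem linear_pauli_eq_zero (h : Op1 →ₗ[ℂ] ℂ)
    (hN : ∀ N : Op1, (∀ s : ℂ, (1 + s • N).det = 1) → (h N).re = 0) (j : Fin 3) :
    h (pauli j.succ) = 0 := by
  obtain ⟨k, hk⟩ : ∃ k, j ≠ k := ⟨j + 1, by fin_cases j <;> decide⟩
  -- Nilpotents are closed under multiplication by i, so vanishing real parts give complex
  -- vanishing. Averaging over e = ± i then isolates σʲ.
  have key : ∀ e : ℂ, e ^ 2 = -1 → h (pauli j.succ + e • pauli k.succ) = 0 := by
    intro e he
    have hdet := fun s => det_one_add_smul_pauli hk s e he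
    have h1 := hN _ hdet
    have h2 := hN (Complex.I • (pauli j.succ + e • pauli k.succ)) fun s => by
      rw [smul_smul]; exact hdet _
    rw [map_smul, smul_eq_mul] at h2
    apply Complex.ext
    · exact h1
    · rw [Complex.I_mul_re] at h2
      exact neg_eq_zero.1 h2
  have h1 := key Complex.I (by simp)
  have h2 := key (-Complex.I) (by simp)
  rw [map_add, map_smul, smul_eq_mul] at h1 h2
  linear_combination (h1 + h2) / 2

theorem trace_mul_pauli_kronecker {W : Op2} (hW : W.IsHermitian) (μ ν : Fin 4) :
    (W * (pauli μ ⊗ₖ pauli ν)).trace = 4 * (coeff W μ ν : ℂ) := by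
  have h : (starRingEnd ℂ) (W * (pauli μ ⊗ₖ pauli ν)).trace = (W * (pauli μ ⊗ₖ pauli ν)).trace := by
    rw [starRingEnd_apply, ← Matrix.trace_conjTranspose, Matrix.conjTranspose_mul, hW.eq,
      Matrix.conjTranspose_kronecker, pauli_hermitian, pauli_hermitian, Matrix.trace_mul_comm]
  rw [← Complex.conj_eq_iff_re.mp h, coeff]
  push_cast
  ring

theorem pauli_mul_self (μ : Fin 4) : pauli μ * pauli μ = pauli 0 := by
  fin_cases μ <;> ext i j <;> fin_cases i <;> fin_cases j <;> simp [pauli]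

theorem pauli_one_mul_two : pauli 1 * pauli 2 = Complex.I • pauli 3 := by
  ext i j; fin_cases i <;> fin_cases j <;> simp [pauli]

theorem pauli_two_mul_one : pauli 2 * pauli 1 = -Complex.I • pauli 3 := by
  ext i j; fin_cases i <;> fin_cases j <;> simp [pauli]

theorem pauli_two_mul_three : pauli 2 * pauli 3 = Complex.I • pauli 1 := by
  ext i j; fin_cases i <;> fin_cases j <;> simp [pauli]

theorem pauli_three_mul_two : pauli 3 * pauli 2 = -Complex.I • pauli 1 := by
  ext i j; fin_cases i <;> fin_cases j <;> simp [pauli]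

theorem pauli_three_mul_one : pauli 3 * pauli 1 = Complex.I • pauli 2 := by
  ext i j; fin_cases i <;> fin_cases j <;> simp [pauli]

theorem pauli_one_mul_three : pauli 1 * pauli 3 = -Complex.I • pauli 2 := by
  ext i j; fin_cases i <;> fin_cases j <;> simp [pauli]

theorem pauli_mul_zero (μ : Fin 4) : pauli μ * pauli 0 = pauli μ := mul_one _

/-- The real parts couple ω₀ⱼ with ωⱼ₀, and the imaginary parts ωⱼₖ with ωₖⱼ. Each system has
determinant ± (dμ² - dν²), nonzero for d = (7, 3, 2, 1). -/
theorem coeff_offDiag_eq_zero {W : Op2} (hW : W.IsHermitian)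
    (hA : ∀ j : Fin 3, (W * ((pauli j.succ ⊗ₖ 1) * referenceState)).trace = 0)
    (hB : ∀ j : Fin 3, (W * ((1 ⊗ₖ pauli j.succ) * referenceState)).trace = 0) :
    ∀ μ ν, μ ≠ ν → coeff W μ ν = 0 := by
  simp only [referenceState, canonicalForm, Fin.sum_univ_four, mul_add, Matrix.mul_smul,
    ← Matrix.mul_kronecker_mul, Matrix.one_mul, Matrix.trace_add, Matrix.trace_smul] at hA hB
  have table := And.intro pauli_one_mul_two <| And.intro pauli_two_mul_one <|
    And.intro pauli_two_mul_three <| And.intro pauli_three_mul_two <|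
    And.intro pauli_three_mul_one pauli_one_mul_three
  have a1 := hA 0
  have a2 := hA 1
  have a3 := hA 2
  have b1 := hB 0
  have b2 := hB 1
  have b3 := hB 2
  simp only [Fin.succ_zero_eq_one, Fin.succ_one_eq_two, show Fin.succ (2 : Fin 3) = 3 from rfl,
    pauli_mul_self, pauli_mul_zero, table, Matrix.smul_kronecker, Matrix.kronecker_smul,
    Matrix.mul_smul, Matrix.trace_smul, trace_mul_pauli_kronecker hW] at a1 a2 a3 b1 b2 b3
  generalize coeff W = ω at *
  simp [Complex.ext_iff] at a1 a2 a3 b1 b2 b3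
  have h01 : ω 0 1 = 0 := by linarith
  have h10 : ω 1 0 = 0 := by linarith
  have h02 : ω 0 2 = 0 := by linarith
  have h20 : ω 2 0 = 0 := by linarith
  have h03 : ω 0 3 = 0 := by linarith
  have h30 : ω 3 0 = 0 := by linarith
  have h12 : ω 1 2 = 0 := by linarith
  have h21 : ω 2 1 = 0 := by linarith
  have h13 : ω 1 3 = 0 := by linarith
  have h31 : ω 3 1 = 0 := by linarith
  have h23 : ω 2 3 = 0 := by linarith
  have h32 : ω 3 2 = 0 := by linarith
  intro μ ν h
  fin_cases μ <;> fin_cases ν <;> first | exact absurd rfl h | assumption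

theorem IsStrictWitness.exists_normalForm {W : Op2} (hW : IsStrictWitness W) :
    ∃ u ∈ openCube, StateEquiv W (normalForm u) := by
  obtain ⟨A, B, hA, hB, hmin⟩ := hW.exists_minimizer
  set V := conjLocal Aᴴ Bᴴ W with hV
  have hVH : V.IsHermitian := isHermitian_conjLocal hW.1 _ _
  have hSH : referenceState.IsHermitian := canonicalForm_isHermitian _
  -- Moving the minimizer from the state to the observable places the minimum for V at the identity.
  have hVmin : ∀ X Y : Op1, X.det = 1 → Y.det = 1 → (V * referenceState).trace.re ≤
      (V * conjLocal X Y referenceState).trace.re := by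
    intro X Y hX hY
    have h1 := hmin (A * X) (B * Y) (by simp [hA, hX]) (by simp [hB, hY])
    rw [← conjLocal_conjLocal] at h1
    simpa only [hV, trace_conjLocal_mul, Matrix.conjTranspose_conjTranspose] using h1
  have hoff : ∀ μ ν, μ ≠ ν → coeff V μ ν = 0 := by
    refine coeff_offDiag_eq_zero hVH ?_ ?_
    · refine linear_pauli_eq_zero
        { toFun := fun X => (V * ((X ⊗ₖ 1) * referenceState)).trace
          map_add' := fun X Y => by simp [Matrix.add_kronecker, add_mul, mul_add]
          map_smul' := fun c X => by simp [Matrix.smul_kronecker] } fun N hN => ?_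
      refine re_trace_eq_zero_of_isMin hVH hSH fun t => ?_
      have := hVmin (1 + (t : ℂ) • N) 1 (hN t) (by simp)
      rwa [conjLocal, Matrix.add_kronecker, Matrix.one_kronecker_one, Matrix.smul_kronecker] at this
    · refine linear_pauli_eq_zero
        { toFun := fun X => (V * ((1 ⊗ₖ X) * referenceState)).trace
          map_add' := fun X Y => by simp [Matrix.kronecker_add, add_mul, mul_add]
          map_smul' := fun c X => by simp [Matrix.kronecker_smul] } fun N hN => ?_
      refine re_trace_eq_zero_of_isMin hVH hSH fun t => ?_
      have := hVmin 1 (1 + (t : ℂ) • N) (by simp) (hN t)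
      rwa [conjLocal, Matrix.kronecker_add, Matrix.one_kronecker_one, Matrix.kronecker_smul] at this
  have hVeq : V = canonicalForm fun μ => coeff V μ μ := by
    conv_lhs => rw [pauli_expansion V hVH]
    refine Finset.sum_congr rfl fun μ _ => Finset.sum_eq_single μ (fun ν _ h => ?_) (by simp)
    simp [hoff μ ν h.symm]
  have hWV : StateEquiv W V := by
    refine (stateEquiv_iff _ _).2 ⟨1, one_pos, Aᴴ, Bᴴ, ?_, ?_, by simp [hV]⟩ <;>
      simp [Matrix.det_conjTranspose, hA, hB]
  have h0 : 0 < coeff V 0 0 := by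
    have h1 := ((isStrictWitness_iff V).1 (hWV.isStrictWitness hW)).2 (Pi.single 0 1)
      (by simp [lightCone]) (Pi.single 0 1) (by simp [lightCone]) (by simp) (by simp)
    simpa using h1
  set u : Fin 3 → ℝ := fun i => coeff V i.succ i.succ / coeff V 0 0
  have hu : normalForm u = (((coeff V 0 0)⁻¹ : ℝ) : ℂ) • conjLocal 1 1 V := by
    have hVs : (((coeff V 0 0)⁻¹ : ℝ) : ℂ) • V =
        canonicalForm ((coeff V 0 0)⁻¹ • fun μ => coeff V μ μ) := by
      rw [canonicalForm_smul, ← hVeq]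
    rw [conjLocal_one, hVs, normalForm]
    congr 1
    ext μ
    refine Fin.cases ?_ (fun i => ?_) μ
    · simp [h0.ne']
    · simp [u, div_eq_inv_mul]
  have hVu : StateEquiv V (normalForm u) :=
    hu ▸ stateEquiv_smul_conjLocal V (by simp) (by simp) (by positivity)
  have hWu := hWV.trans hVu
  exact ⟨u, (hWu.isStrictWitness hW).mem_openCube, hWu⟩

/-! ### Lorentz singular values -/

theorem det_minkowski : minkowski.det = -1 := by
  simp [minkowski, Fin.prod_univ_four]

theorem det_gram (W : Op2) : (gram W).det = (coeff W).det ^ 2 := by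
  rw [gram, minkowskiAdjoint, Matrix.det_mul, Matrix.det_mul, Matrix.det_mul,
    Matrix.det_transpose, det_minkowski]
  ring

theorem charpoly_eq_prod_iff (M : Matrix (Fin 4) (Fin 4) ℝ) (s : Fin 4 → ℝ) :
    M.charpoly = ∏ α, (Polynomial.X - Polynomial.C (s α ^ 2)) ↔
      ∀ t, (Matrix.scalar (Fin 4) t - M).det = ∏ α, (t - s α ^ 2) := by
  constructor
  · intro h t
    rw [← Matrix.eval_charpoly, h, Polynomial.eval_prod]
    simp
  · intro h
    refine Polynomial.funext fun t => ?_
    rw [Matrix.eval_charpoly, h, Polynomial.eval_prod]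
    simp

/-- A sign condition is not closed, whereas the product equation is. They agree because s₀, s₁, s₂ ≥
0 and the squares of both sides coincide already. -/
theorem sign_eq_iff_prod_eq {s : Fin 4 → ℝ} {δ : ℝ} (h1 : s 1 ≤ s 0) (h2 : s 2 ≤ s 1)
    (h3 : |s 3| ≤ s 2) (hp : (∏ α, s α) ^ 2 = δ ^ 2) :
    SignType.sign (s 3) = SignType.sign δ ↔ ∏ α, s α = δ := by
  have hs2 : 0 ≤ s 2 := (abs_nonneg _).trans h3
  have hs1 : 0 ≤ s 1 := hs2.trans h2
  have hs0 : 0 ≤ s 0 := hs1.trans h1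
  have hq : 0 ≤ s 0 * s 1 * s 2 := by positivity
  rw [Fin.prod_univ_four] at *
  rcases lt_trichotomy (s 3) 0 with h | h | h
  · have hq' : 0 < s 0 * s 1 * s 2 := by
      have : 0 < s 2 := (abs_pos.2 h.ne).trans_le h3
      have : 0 < s 1 := by linarith
      have : 0 < s 0 := by linarith
      positivity
    have hneg : s 0 * s 1 * s 2 * s 3 < 0 := mul_neg_of_pos_of_neg hq' h
    rw [sign_neg h]
    constructor
    · intro h4
      have h5 : δ < 0 := sign_eq_neg_one_iff.1 h4.symm
      rcases sq_eq_sq_iff_eq_or_eq_neg.1 hp with h6 | h6 <;> linarith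
    · intro h4
      rw [← h4, sign_neg hneg]
  · rw [h, mul_zero] at hp ⊢
    have : δ = 0 := by simpa using hp.symm
    simp [this]
  · have hq' : 0 < s 0 * s 1 * s 2 := by
      have : 0 < s 2 := (abs_pos.2 h.ne').trans_le h3
      have : 0 < s 1 := by linarith
      have : 0 < s 0 := by linarith
      positivity
    have hpos : 0 < s 0 * s 1 * s 2 * s 3 := mul_pos hq' h
    rw [sign_pos h]
    constructor
    · intro h4
      have h5 : 0 < δ := sign_eq_one_iff.1 h4.symm
      rcases sq_eq_sq_iff_eq_or_eq_neg.1 hp with h6 | h6 <;> linarith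
    · intro h4
      rw [← h4, sign_pos hpos]

/-- Lorentz singular values are characterized by polynomial equations and weak inequalities. -/
theorem isLorentzSingularValues_iff (W : Op2) (s : Fin 4 → ℝ) : IsLorentzSingularValues W s ↔
    (∀ t, (Matrix.scalar (Fin 4) t - gram W).det = ∏ α, (t - s α ^ 2)) ∧
      s 1 ≤ s 0 ∧ s 2 ≤ s 1 ∧ |s 3| ≤ s 2 ∧ ∏ α, s α = (coeff W).det := by
  rw [IsLorentzSingularValues, ← gram, charpoly_eq_prod_iff]
  refine and_congr_right fun h => and_congr_right fun h1 => and_congr_right fun h2 =>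
    and_congr_right fun h3 => sign_eq_iff_prod_eq h1 h2 h3 ?_
  have h0 := h 0
  rw [map_zero, zero_sub, Matrix.det_neg, det_gram] at h0
  rw [← Finset.prod_pow]
  simp only [Fintype.card_fin, zero_sub, Fin.prod_univ_four] at h0 ⊢
  linarith

theorem IsLorentzSingularValues.smul_of_stateEquiv {W W' : Op2} (h : StateEquiv W W') :
    ∃ r : ℝ, 0 < r ∧ ∀ s, IsLorentzSingularValues W s → IsLorentzSingularValues W' (r • s) := by
  obtain ⟨r, hr, A, B, hA, hB, rfl⟩ := (stateEquiv_iff _ _).1 h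
  refine ⟨r, hr, fun s hs => ?_⟩
  rw [isLorentzSingularValues_iff] at hs ⊢
  obtain ⟨h0, h1, h2, h3, h4⟩ := hs
  refine ⟨fun t => ?_, mul_le_mul_of_nonneg_left h1 hr.le, mul_le_mul_of_nonneg_left h2 hr.le,
    ?_, ?_⟩
  · rw [det_sub_gram_smul_conjLocal hr.ne' hA hB, h0]
    simp only [Fin.prod_univ_four, Pi.smul_apply, smul_eq_mul]
    field_simp
  · simp only [Pi.smul_apply, smul_eq_mul, abs_mul, abs_of_pos hr]
    exact mul_le_mul_of_nonneg_left h3 hr.le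
  · rw [det_coeff_smul_conjLocal r hA hB, ← h4]
    simp only [Fin.prod_univ_four, Pi.smul_apply, smul_eq_mul]
    ring

theorem IsLorentzSingularValues.abs_le {W : Op2} {s : Fin 4 → ℝ}
    (h : IsLorentzSingularValues W s) : ∀ α, |s α| ≤ s 0 := by
  obtain ⟨-, h1, h2, h3, -⟩ := h
  have hs2 : 0 ≤ s 2 := (abs_nonneg _).trans h3
  intro α
  fin_cases α
  · exact (abs_of_nonneg ((hs2.trans h2).trans h1)).le
  · exact (abs_of_nonneg (hs2.trans h2)).trans_le h1
  · exact (abs_of_nonneg hs2).trans_le (by linarith)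
  · exact h3.trans (by linarith)

/-- The characteristic polynomial determines the multiset of squares, the ordering determines the
list, and the sign of det ω settles s₃. -/
theorem IsLorentzSingularValues.unique {W : Op2} {s s' : Fin 4 → ℝ}
    (h : IsLorentzSingularValues W s) (h' : IsLorentzSingularValues W s') : s = s' := by
  obtain ⟨hc, h1, h2, h3, h4⟩ := h
  obtain ⟨hc', h1', h2', h3', h4'⟩ := h'
  have hs2 : 0 ≤ s 2 := (abs_nonneg _).trans h3
  have hs2' : 0 ≤ s' 2 := (abs_nonneg _).trans h3'
  have hsorted : ∀ s : Fin 4 → ℝ, s 1 ≤ s 0 → s 2 ≤ s 1 → |s 3| ≤ s 2 →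
      (List.ofFn fun α => s α ^ 2).Pairwise (· ≥ ·) := by
    intro s h1 h2 h3
    have h0 : 0 ≤ |s 3| := abs_nonneg _
    have e1 : s 3 ^ 2 ≤ s 2 ^ 2 := by rw [← sq_abs (s 3)]; nlinarith
    have e2 : s 2 ^ 2 ≤ s 1 ^ 2 := by nlinarith
    have e3 : s 1 ^ 2 ≤ s 0 ^ 2 := by nlinarith
    simp [List.ofFn_succ, show Fin.succ (2 : Fin 3) = 3 from rfl]
    refine ⟨⟨?_, ?_, ?_⟩, ⟨?_, ?_⟩, ?_⟩ <;> linarith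
  have hroots : ∀ s : Fin 4 → ℝ,
      (∏ α, (Polynomial.X - Polynomial.C (s α ^ 2))).roots = ↑(List.ofFn fun α => s α ^ 2) := by
    intro s
    have := Polynomial.roots_multiset_prod_X_sub_C (↑(List.ofFn fun α => s α ^ 2) : Multiset ℝ)
    rw [← this, Multiset.map_coe, Multiset.prod_coe, List.map_ofFn, List.prod_ofFn]
    rfl
  have hperm : List.Perm (List.ofFn fun α => s α ^ 2) (List.ofFn fun α => s' α ^ 2) := by
    rw [← Multiset.coe_eq_coe, ← hroots, ← hroots, ← hc, hc']
  have heq := List.ofFn_injective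
    (hperm.eq_of_pairwise' (hsorted s h1 h2 h3) (hsorted s' h1' h2' h3'))
  have hsq := fun α => congrFun heq α
  have habs : ∀ α, |s α| = |s' α| := fun α => sq_eq_sq_iff_abs_eq_abs _ _ |>.1 (hsq α)
  have e2 : s 2 = s' 2 := by
    simpa [abs_of_nonneg hs2, abs_of_nonneg hs2'] using habs 2
  have e1 : s 1 = s' 1 := by
    simpa [abs_of_nonneg (hs2.trans h2), abs_of_nonneg (hs2'.trans h2')] using habs 1
  have e0 : s 0 = s' 0 := by
    simpa [abs_of_nonneg ((hs2.trans h2).trans h1), abs_of_nonneg ((hs2'.trans h2').trans h1')]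
      using habs 0
  have e3 : s 3 = s' 3 := by
    rw [← sign_mul_abs (s 3), ← sign_mul_abs (s' 3), habs 3, h4, h4']
  ext α
  fin_cases α <;> assumption

theorem gram_canonicalForm (d : Fin 4 → ℝ) :
    gram (canonicalForm d) = Matrix.diagonal fun α => d α ^ 2 := by
  rw [gram, coeff_canonicalForm, minkowskiAdjoint, minkowski, Matrix.diagonal_transpose,
    Matrix.diagonal_mul_diagonal, Matrix.diagonal_mul_diagonal, Matrix.diagonal_mul_diagonal]
  congr 1
  ext α
  fin_cases α <;> simp <;> ring

theorem isLorentzSingularValues_canonicalForm {d : Fin 4 → ℝ} (h1 : d 1 ≤ d 0) (h2 : d 2 ≤ d 1)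
    (h3 : |d 3| ≤ d 2) : IsLorentzSingularValues (canonicalForm d) d := by
  refine (isLorentzSingularValues_iff _ _).2 ⟨fun t => ?_, h1, h2, h3, ?_⟩
  · rw [gram_canonicalForm, Matrix.scalar_apply, Matrix.diagonal_sub, Matrix.det_diagonal]
  · rw [coeff_canonicalForm, Matrix.det_diagonal]

theorem isLorentzSingularValues_normalForm {u : Fin 3 → ℝ} (hu : u ∈ cube) (h1 : u 1 ≤ u 0)
    (h2 : |u 2| ≤ u 1) : IsLorentzSingularValues (normalForm u) (Matrix.vecCons 1 u) :=
  isLorentzSingularValues_canonicalForm (by simpa using (abs_le.1 (hu 0)).2) (by simpa using h1)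
    (by simpa using h2)

theorem IsStrictWitness.exists_sorted_normalForm {W : Op2} (hW : IsStrictWitness W) :
    ∃ u ∈ openCube, StateEquiv W (normalForm u) ∧
      ∃ r : ℝ, 0 < r ∧ IsLorentzSingularValues W (r • Matrix.vecCons 1 u) := by
  obtain ⟨u, hu, hWu⟩ := hW.exists_normalForm
  obtain ⟨v, hv, h1, h2⟩ := exists_sorted_mem_orbit u
  have hvc := mem_openCube_of_mem_orbit hv hu
  have hWv := hWu.trans (stateEquiv_of_mem_orbit hv)
  obtain ⟨r, hr, h⟩ := IsLorentzSingularValues.smul_of_stateEquiv hWv.symm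
  exact ⟨v, hvc, hWv, r, hr,
    h _ (isLorentzSingularValues_normalForm (openCube_subset_cube hvc) h1 h2)⟩

/-! ### Existence of Lorentz singular values by approximation -/

theorem IsPotentialWitness.add_smul_isStrictWitness {W V : Op2} (hW : IsPotentialWitness W)
    (hV : IsStrictWitness V) {ε : ℝ} (hε : 0 < ε) : IsStrictWitness (W + (ε : ℂ) • V) := by
  refine ⟨hW.1.add (isHermitian_real_smul hV.1 ε), fun ρ hρ h0 => ?_⟩
  rw [add_mul, Matrix.trace_add, Complex.add_re, re_trace_smul_mul]
  exact add_pos_of_nonneg_of_pos (hW.2 ρ hρ) (mul_pos hε (hV.2 ρ hρ h0))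

/-- This bounds the singular values by continuous data, as the compactness argument in the limit
requires. -/
theorem IsLorentzSingularValues.sum_sq {W : Op2} {s : Fin 4 → ℝ}
    (h : IsLorentzSingularValues W s) : ∑ α, s α ^ 2 = (gram W).trace := by
  rw [Matrix.trace_eq_neg_charpoly_nextCoeff, gram, h.1, Polynomial.prod_X_sub_C_nextCoeff, neg_neg]

open Filter Topology in
/-- A closed property of the Lorentz singular values passes to limits. -/
theorem exists_isLorentzSingularValues_of_approx (W V : Op2) {C : Set (Fin 4 → ℝ)}
    (hC : IsClosed C)
    (h : ∀ ε : ℝ, 0 < ε → ∃ s ∈ C, IsLorentzSingularValues (W + (ε : ℂ) • V) s) :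
    ∃ s ∈ C, IsLorentzSingularValues W s := by
  have hω : ∀ ε : ℝ, coeff (W + (ε : ℂ) • V) = coeff W + ε • coeff V := fun ε => by
    rw [coeff_add, coeff_smul]
  have hωc : Continuous fun ε : ℝ => coeff (W + (ε : ℂ) • V) := by
    simp only [hω]
    fun_prop
  have hgc : Continuous fun ε : ℝ => gram (W + (ε : ℂ) • V) := by
    unfold gram minkowskiAdjoint
    exact ((continuous_const.matrix_mul hωc.matrix_transpose).matrix_mul
      continuous_const).matrix_mul hωc
  let e : ℕ → ℝ := fun n => 1 / ((n : ℝ) + 1)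
  have he : Tendsto e atTop (𝓝 0) := tendsto_one_div_add_atTop_nhds_zero_nat
  have hepos : ∀ n, 0 < e n := fun n => by positivity
  choose s hsC hs using fun n => h (e n) (hepos n)
  have htr : Tendsto (fun n => (gram (W + (e n : ℂ) • V)).trace) atTop
      (𝓝 (gram (W + ((0 : ℝ) : ℂ) • V)).trace) :=
    (hgc.matrix_trace.tendsto 0).comp he
  obtain ⟨b, hb⟩ := htr.bddAbove_range
  have hbound : ∀ n, s n ∈ Set.Icc (fun _ : Fin 4 => -(b + 1)) (fun _ => b + 1) := by
    intro n
    have h1 := (hs n).sum_sq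
    have h2 : (gram (W + (e n : ℂ) • V)).trace ≤ b := hb ⟨n, rfl⟩
    rw [Set.mem_Icc, Pi.le_def, Pi.le_def, ← forall_and]
    intro α
    rw [← abs_le]
    have h3 : s n α ^ 2 ≤ ∑ α, s n α ^ 2 :=
      Finset.single_le_sum (f := fun α => s n α ^ 2) (fun _ _ => sq_nonneg _) (Finset.mem_univ α)
    rw [← sq_abs] at h3
    nlinarith [sq_nonneg (|s n α| - 1)]
  obtain ⟨a, -, φ, hφ, ha⟩ := isCompact_Icc.tendsto_subseq hbound
  have hlim : Tendsto (fun n => (e (φ n), s (φ n))) atTop (𝓝 ((0 : ℝ), a)) :=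
    (he.comp hφ.tendsto_atTop).prodMk_nhds ha
  -- Closedness is needed jointly in ε and s, since the operator varies along with its singular
  -- values.
  have hclosed : IsClosed {p : ℝ × (Fin 4 → ℝ) | p.2 ∈ C ∧
      (∀ t, (Matrix.scalar (Fin 4) t - gram (W + (p.1 : ℂ) • V)).det = ∏ α, (t - p.2 α ^ 2)) ∧
      p.2 1 ≤ p.2 0 ∧ p.2 2 ≤ p.2 1 ∧ |p.2 3| ≤ p.2 2 ∧
      ∏ α, p.2 α = (coeff (W + (p.1 : ℂ) • V)).det} := by
    have hdet : IsClosed {p : ℝ × (Fin 4 → ℝ) | ∀ t,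
        (Matrix.scalar (Fin 4) t - gram (W + (p.1 : ℂ) • V)).det = ∏ α, (t - p.2 α ^ 2)} := by
      simp only [Set.ofPred_forall]
      exact isClosed_iInter fun t => isClosed_eq
        (continuous_const.sub (hgc.comp continuous_fst)).matrix_det (by fun_prop)
    have h1 : IsClosed {p : ℝ × (Fin 4 → ℝ) | p.2 1 ≤ p.2 0} :=
      isClosed_le (by fun_prop) (by fun_prop)
    have h2 : IsClosed {p : ℝ × (Fin 4 → ℝ) | p.2 2 ≤ p.2 1} :=
      isClosed_le (by fun_prop) (by fun_prop)
    have h3 : IsClosed {p : ℝ × (Fin 4 → ℝ) | |p.2 3| ≤ p.2 2} :=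
      isClosed_le (by fun_prop) (by fun_prop)
    have h4 : IsClosed {p : ℝ × (Fin 4 → ℝ) | ∏ α, p.2 α = (coeff (W + (p.1 : ℂ) • V)).det} :=
      isClosed_eq (by fun_prop) (hωc.comp continuous_fst).matrix_det
    exact (hC.preimage continuous_snd).inter
      (hdet.inter (h1.inter (h2.inter (h3.inter h4))))
  have hmem := hclosed.mem_of_tendsto hlim (Eventually.of_forall fun n =>
    ⟨hsC (φ n), (isLorentzSingularValues_iff _ _).1 (hs (φ n))⟩)
  refine ⟨a, hmem.1, (isLorentzSingularValues_iff _ _).2 ?_⟩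
  simpa using hmem.2

theorem zero_mem_openCube : (0 : Fin 3 → ℝ) ∈ openCube := fun i => by simp

theorem isSeparable_normalForm_zero : IsSeparable (normalForm 0) :=
  (isSeparable_normalForm_iff 0).2 ((mem_octahedron_iff 0).2 (by simp))

theorem IsPotentialWitness.exists_isLorentzSingularValues {W : Op2} (hW : IsPotentialWitness W) :
    ∃ s, IsLorentzSingularValues W s := by
  obtain ⟨s, -, hs⟩ := exists_isLorentzSingularValues_of_approx W (normalForm 0) isClosed_univ
    fun ε hε => by
      obtain ⟨u, -, -, r, -, h⟩ := (hW.add_smul_isStrictWitness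
        (isStrictWitness_normalForm zero_mem_openCube) hε).exists_sorted_normalForm
      exact ⟨_, trivial, h⟩
  exact ⟨s, hs⟩

/-- Adding ε·1 yields a strict witness that is still a state, and its normal form lies in the
tetrahedron. The inequality is written homogeneously so that it remains meaningful when s₀ = 0 in
the limit. -/
theorem IsState.singularValues {ρ : Op2} (hρ : IsState ρ) {s : Fin 4 → ℝ}
    (hs : IsLorentzSingularValues ρ s) (δ : Fin 3 → ℤˣ) (hδ : ∏ i, δ i = -1) :
    0 ≤ s 0 + ∑ i, ((δ i : ℤ) : ℝ) * s i.succ := by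
  obtain ⟨s', hs', h⟩ := exists_isLorentzSingularValues_of_approx ρ (normalForm 0)
    (C := {s | 0 ≤ s 0 + ∑ i, ((δ i : ℤ) : ℝ) * s i.succ})
    (isClosed_le continuous_const (by fun_prop)) fun ε hε => by
      have hst : IsState (ρ + (ε : ℂ) • normalForm 0) := Matrix.PosSemidef.add hρ
        (isSeparable_normalForm_zero.smul hε.le).isState
      obtain ⟨u, -, hu, r, hr, h⟩ := (hρ.isPotentialWitness.add_smul_isStrictWitness
        (isStrictWitness_normalForm zero_mem_openCube) hε).exists_sorted_normalForm
      refine ⟨_, ?_, h⟩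
      have h1 := (mem_tetrahedron_iff u).1 ((isState_normalForm_iff u).1 (hu.isState hst)) δ hδ
      have h2 := mul_nonneg hr.le h1
      rw [mul_add, mul_one, Finset.mul_sum] at h2
      simp only [Set.mem_ofPred_eq, Pi.smul_apply, Matrix.cons_val_zero, Matrix.cons_val_succ,
        smul_eq_mul, mul_one]
      simpa only [mul_left_comm] using h2
  rw [hs.unique h]
  exact hs'

theorem IsSeparable.singularValues {ρ : Op2} (hρ : IsSeparable ρ) {s : Fin 4 → ℝ}
    (hs : IsLorentzSingularValues ρ s) : ∑ i : Fin 3, |s i.succ| ≤ s 0 := by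
  obtain ⟨s', hs', h⟩ := exists_isLorentzSingularValues_of_approx ρ (normalForm 0)
    (C := {s | ∑ i : Fin 3, |s i.succ| ≤ s 0})
    (isClosed_le (by fun_prop) (by fun_prop)) fun ε hε => by
      have hst : IsSeparable (ρ + (ε : ℂ) • normalForm 0) :=
        hρ.add (isSeparable_normalForm_zero.smul hε.le)
      obtain ⟨u, -, hu, r, hr, h⟩ := (hρ.isState.isPotentialWitness.add_smul_isStrictWitness
        (isStrictWitness_normalForm zero_mem_openCube) hε).exists_sorted_normalForm
      refine ⟨_, ?_, h⟩
      have h1 := (mem_octahedron_iff u).1 ((isSeparable_normalForm_iff u).1 (hu.isSeparable hst))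
      have h2 := mul_le_mul_of_nonneg_left h1 hr.le
      rw [Finset.mul_sum] at h2
      simpa [abs_mul, abs_of_pos hr] using h2
  rw [hs.unique h]
  exact hs'

/-! ### Points in space -/

theorem sloccPoints_eq_orbit {W : Op2} {s : Fin 4 → ℝ} (hs : IsLorentzSingularValues W s)
    (h0 : s 0 ≠ 0) : sloccPoints W = MulAction.orbit tetrahedralGroup (normalizedVector s) := by
  ext v
  constructor
  · rintro ⟨s', hs', -, hv⟩
    rwa [hs.unique hs']
  · exact fun hv => ⟨s, hs, h0, hv⟩

theorem normalizedVector_smul {r : ℝ} (hr : r ≠ 0) (s : Fin 4 → ℝ) :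
    normalizedVector (r • s) = normalizedVector s := by
  ext i
  simp [normalizedVector, mul_div_mul_left _ _ hr]

theorem sloccPoints_subset_of_stateEquiv {W W' : Op2} (h : StateEquiv W W') :
    sloccPoints W ⊆ sloccPoints W' := by
  rintro v ⟨s, hs, h0, hv⟩
  obtain ⟨r, hr, h1⟩ := IsLorentzSingularValues.smul_of_stateEquiv h
  exact ⟨_, h1 s hs, mul_ne_zero hr.ne' h0, by rwa [normalizedVector_smul hr.ne']⟩

theorem StateEquiv.sloccPoints_eq {W W' : Op2} (h : StateEquiv W W') :
    sloccPoints W = sloccPoints W' :=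
  Set.Subset.antisymm (sloccPoints_subset_of_stateEquiv h) (sloccPoints_subset_of_stateEquiv h.symm)

/-- Membership in the cube makes the leading coefficient 1 the largest singular value, so
normalization returns the sorted representative of the orbit. -/
theorem sloccPoints_normalForm {u : Fin 3 → ℝ} (hu : u ∈ cube) :
    sloccPoints (normalForm u) = MulAction.orbit tetrahedralGroup u := by
  obtain ⟨v, hv, h1, h2⟩ := exists_sorted_mem_orbit u
  rw [(stateEquiv_of_mem_orbit hv).sloccPoints_eq, sloccPoints_eq_orbit
    (isLorentzSingularValues_normalForm (mem_cube_of_mem_orbit hv hu) h1 h2) (by simp),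
    ← MulAction.orbit_eq_iff.2 hv]
  congr 1
  ext i
  simp [normalizedVector]

theorem sloccPoints_subset_cube (W : Op2) : sloccPoints W ⊆ cube := by
  rintro v ⟨s, hs, h0, hv⟩
  refine mem_cube_of_mem_orbit hv fun i => ?_
  have h1 : 0 < s 0 := lt_of_le_of_ne ((abs_nonneg _).trans (hs.abs_le 0)) h0.symm
  rw [normalizedVector, abs_div, abs_of_pos h1, div_le_one h1]
  exact hs.abs_le _

theorem IsState.sloccPoints_subset {ρ : Op2} (hρ : IsState ρ) : sloccPoints ρ ⊆ tetrahedron := by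
  rintro v ⟨s, hs, h0, hv⟩
  refine mem_tetrahedron_of_mem_orbit hv ((mem_tetrahedron_iff _).2 fun δ hδ => ?_)
  have h1 : 0 < s 0 := lt_of_le_of_ne ((abs_nonneg _).trans (hs.abs_le 0)) h0.symm
  have h2 := div_nonneg (hρ.singularValues hs δ hδ) h1.le
  rw [add_div, div_self h0, Finset.sum_div] at h2
  simpa only [normalizedVector, mul_div_assoc] using h2

theorem IsSeparable.sloccPoints_subset {ρ : Op2} (hρ : IsSeparable ρ) :
    sloccPoints ρ ⊆ octahedron := by
  rintro v ⟨s, hs, h0, hv⟩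
  refine mem_octahedron_of_mem_orbit hv ((mem_octahedron_iff _).2 ?_)
  have h1 : 0 < s 0 := lt_of_le_of_ne ((abs_nonneg _).trans (hs.abs_le 0)) h0.symm
  have h2 := div_le_one_of_le₀ (hρ.singularValues hs) h1.le
  rw [Finset.sum_div] at h2
  simpa only [normalizedVector, abs_div, abs_of_pos h1] using h2

theorem IsStrictWitness.sloccPoints_eq {W : Op2} (hW : IsStrictWitness W) :
    ∃ u ∈ openCube, StateEquiv W (normalForm u) ∧
      sloccPoints W = MulAction.orbit tetrahedralGroup u := by
  obtain ⟨u, hu, h⟩ := hW.exists_normalForm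
  exact ⟨u, hu, h, h.sloccPoints_eq.trans (sloccPoints_normalForm (openCube_subset_cube hu))⟩

theorem octahedron_subset_cube : octahedron ⊆ cube := fun y hy i =>
  (Finset.single_le_sum (f := fun i => |y i|) (fun _ _ => abs_nonneg _)
    (Finset.mem_univ i)).trans ((mem_octahedron_iff y).1 hy)

theorem tetrahedron_subset_cube : tetrahedron ⊆ cube := by
  intro x hx i
  obtain ⟨h1, h2, h3, h4⟩ := (mem_tetrahedron_iff_four x).1 hx
  fin_cases i <;> exact abs_le.2 ⟨by simp; linarith, by simp; linarith⟩

/-! ### Inequivalent witnesses represented by the same points -/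

/-- The separable operator `1 ⊗ (1 - σ¹) + (1 + σ¹) ⊗ 1`, for which `ω⋆ω` is not diagonalizable. -/
def jordanWitness : Op2 := bloch ![1, 0, 0, 0] ⊗ₖ bloch ![1, -1, 0, 0] +
  bloch ![1, 1, 0, 0] ⊗ₖ bloch ![1, 0, 0, 0]

theorem isSeparable_jordanWitness : IsSeparable jordanWitness := by
  refine (isSeparable_kronecker ?_ ?_).add (isSeparable_kronecker ?_ ?_) <;>
    rw [bloch_posSemidef_iff] <;> simp [lightCone]

theorem coeff_bloch_kronecker (x y : Fin 4 → ℝ) :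
    coeff (bloch x ⊗ₖ bloch y) = Matrix.vecMulVec x y := by
  ext μ ν
  have h : ∀ (x : Fin 4 → ℝ) μ, (bloch x * pauli μ).trace = 2 * (x μ : ℂ) := by
    intro x μ
    simp only [bloch, Finset.sum_mul, Matrix.trace_sum, Matrix.smul_mul, Matrix.trace_smul,
      trace_pauli_mul_pauli]
    simp
    ring
  rw [coeff, ← Matrix.mul_kronecker_mul, Matrix.trace_kronecker, h, h, Matrix.vecMulVec_apply]
  norm_cast
  ring

theorem gram_jordanWitness : gram jordanWitness =
    !![3, -2, 0, 0; 2, -1, 0, 0; 0, 0, 0, 0; 0, 0, 0, 0] := by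
  rw [gram, jordanWitness, coeff_add, coeff_bloch_kronecker, coeff_bloch_kronecker,
    minkowskiAdjoint, minkowski]
  ext i j
  fin_cases i <;> fin_cases j <;>
    simp [Matrix.mul_apply, Fin.sum_univ_four, Matrix.diagonal_apply] <;>
    norm_num

/-- The nonzero 2 × 2 block of ω⋆ω has characteristic polynomial (t - 1)² without being the
identity. -/
theorem isLorentzSingularValues_jordanWitness :
    IsLorentzSingularValues jordanWitness ![1, 1, 0, 0] := by
  refine (isLorentzSingularValues_iff _ _).2 ⟨fun t => ?_, by simp, by simp, by simp, ?_⟩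
  · have h : Matrix.scalar (Fin 4) t - gram jordanWitness =
        !![t - 3, 2, 0, 0; -2, t + 1, 0, 0; 0, 0, t, 0; 0, 0, 0, t] := by
      rw [gram_jordanWitness]
      ext i j
      fin_cases i <;> fin_cases j <;> simp
    rw [h]
    simp [Matrix.det_succ_row_zero, Fin.sum_univ_succ, Fin.prod_univ_four, Fin.succAbove]
    ring
  · have h := det_gram jordanWitness
    rw [gram_jordanWitness] at h
    have h0 : (!![3, -2, 0, 0; 2, -1, 0, 0; 0, 0, 0, 0; 0, 0, 0, 0] :
        Matrix (Fin 4) (Fin 4) ℝ).det = 0 :=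
      Matrix.det_eq_zero_of_row_eq_zero 3 fun j => by fin_cases j <;> rfl
    rw [h0] at h
    rw [pow_eq_zero_iff two_ne_zero |>.1 h.symm]
    simp [Fin.prod_univ_four]

theorem exists_inequivalent_of_sloccPoints_eq :
    ∃ W W', IsPotentialWitness W ∧ IsPotentialWitness W' ∧ (sloccPoints W).Nonempty ∧
      sloccPoints W = sloccPoints W' ∧ ¬ WitnessEquiv W W' := by
  have hu : (![1, 0, 0] : Fin 3 → ℝ) ∈ cube := fun i => by fin_cases i <;> simp
  have hs : IsLorentzSingularValues (normalForm ![1, 0, 0]) ![1, 1, 0, 0] :=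
    isLorentzSingularValues_normalForm hu (by simp) (by simp)
  refine ⟨normalForm ![1, 0, 0], jordanWitness, (isPotentialWitness_normalForm_iff _).2 hu,
    isSeparable_jordanWitness.isState.isPotentialWitness, ?_, ?_, ?_⟩
  · rw [sloccPoints_normalForm hu]
    exact MulAction.nonempty_orbit _
  · rw [sloccPoints_eq_orbit hs (by simp),
      sloccPoints_eq_orbit isLorentzSingularValues_jordanWitness (by simp)]
  · rw [witnessEquiv_iff_stateEquiv, stateEquiv_iff]
    rintro ⟨r, hr, A, B, hA, hB, h⟩
    have hg := gram_smul_conjLocal r hA B (normalForm ![1, 0, 0])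
    rw [← h] at hg
    set N := lorentz Bᴴ
    set K := minkowskiAdjoint N
    have hB' : (Bᴴ).det = 1 := by simp [Matrix.det_conjTranspose, hB]
    have hNK : N * K = 1 := lorentz_mul_minkowskiAdjoint hB'
    set G := gram (normalForm ![1, 0, 0])
    have hG : G = Matrix.diagonal ![1, 1, 0, 0] := by
      simp only [G, normalForm, gram_canonicalForm]
      congr 1
      ext i
      fin_cases i <;> simp
    have hGG : G * G = G := by
      rw [hG, Matrix.diagonal_mul_diagonal]
      congr 1
      ext i
      fin_cases i <;> simp
    -- Both Gram matrices have trace 2, which forces r² = 1.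
    have htr := congrArg Matrix.trace hg
    rw [Matrix.trace_smul, Matrix.trace_mul_comm, ← Matrix.mul_assoc, hNK, Matrix.one_mul,
      gram_jordanWitness, hG] at htr
    simp [Matrix.trace, Fin.sum_univ_four] at htr
    have hr1 : r ^ 2 = 1 := by linarith
    rw [hr1, one_smul] at hg
    -- Similarity would transport the idempotency of diag(1, 1, 0, 0) to the Jordan block, whose
    -- square has corner entry 9 - 4 = 5 instead of 3.
    have hsq : gram jordanWitness * gram jordanWitness = gram jordanWitness := by
      rw [hg]
      calc _ = K * G * (N * K) * G * N := by simp only [Matrix.mul_assoc]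
        _ = _ := by rw [hNK, Matrix.mul_one, Matrix.mul_assoc K, hGG]
    have h01 := congrFun (congrFun hsq 0) 0
    rw [gram_jordanWitness] at h01
    simp [Matrix.mul_apply, Fin.sum_univ_four] at h01
    norm_num at h01

end

end TwoQubit

open TwoQubit in
theorem mainTheorem2 :
    -- the three cones are nested and preserved by SLOCC
    (∀ ρ, IsSeparable ρ → IsState ρ) ∧ (∀ ρ, IsState ρ → IsPotentialWitness ρ) ∧
    (∀ ρ ρ', StateEquiv ρ ρ' → IsSeparable ρ → IsSeparable ρ') ∧
    (∀ ρ ρ', StateEquiv ρ ρ' → IsState ρ → IsState ρ') ∧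
    (∀ W W', WitnessEquiv W W' → IsPotentialWitness W → IsPotentialWitness W') ∧
    -- both actions induce the same equivalence relation
    Equivalence StateEquiv ∧ (∀ X Y, WitnessEquiv X Y ↔ StateEquiv X Y) ∧
    -- Lorentz singular values are well defined and the points in space are SLOCC invariant
    (∀ W, IsPotentialWitness W → ∃! s, IsLorentzSingularValues W s) ∧
    (∀ W W', IsPotentialWitness W → WitnessEquiv W W' → sloccPoints W' = sloccPoints W) ∧
    -- the 24-element tetrahedral group
    Nat.card tetrahedralGroup = 24 ∧
    (∀ g ∈ tetrahedralGroup, g '' tetrahedron = tetrahedron) ∧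
    -- operators in canonical form
    (∀ d : Fin 4 → ℝ, (canonicalForm d).charpoly = ∏ ε₁ : ℤˣ, ∏ ε₂ : ℤˣ,
      (Polynomial.X - Polynomial.C (((d 0 + ((ε₁ : ℤ) : ℝ) * d 1 + ((ε₂ : ℤ) : ℝ) * d 2
        - ((ε₁ : ℤ) : ℝ) * ((ε₂ : ℤ) : ℝ) * d 3 : ℝ) : ℂ)))) ∧
    (∀ u, IsPotentialWitness (normalForm u) ↔ u ∈ cube) ∧
    (∀ u, IsState (normalForm u) ↔ u ∈ tetrahedron) ∧
    (∀ u, IsSeparable (normalForm u) ↔ u ∈ octahedron) ∧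
    (∀ u ∈ cube, sloccPoints (normalForm u) = MulAction.orbit tetrahedralGroup u) ∧
    (∀ u ∈ cube, ∀ u' ∈ cube, WitnessEquiv (normalForm u) (normalForm u') ↔
      u' ∈ MulAction.orbit tetrahedralGroup u) ∧
    -- strict witnesses are classified by their points
    (∀ W, IsStrictWitness W → ∃ u ∈ openCube, WitnessEquiv W (normalForm u)) ∧
    (∀ W W', IsStrictWitness W → IsStrictWitness W' →
      (WitnessEquiv W W' ↔ sloccPoints W = sloccPoints W')) ∧
    (∀ W, IsStrictWitness W → (IsState W ↔ sloccPoints W ⊆ tetrahedron)) ∧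
    (∀ W, IsStrictWitness W → (IsSeparable W ↔ sloccPoints W ⊆ octahedron)) ∧
    (⋃ W ∈ {W | IsStrictWitness W}, sloccPoints W) = openCube ∧
    -- without strictness this fails
    (∃ W W', IsPotentialWitness W ∧ IsPotentialWitness W' ∧ (sloccPoints W).Nonempty ∧
      sloccPoints W = sloccPoints W' ∧ ¬ WitnessEquiv W W') ∧
    -- the cube, the tetrahedron and the octahedron
    (⋃ W ∈ {W | IsPotentialWitness W}, sloccPoints W) = cube ∧
    (⋃ ρ ∈ {ρ | IsState ρ}, sloccPoints ρ) = tetrahedron ∧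
    (⋃ ρ ∈ {ρ | IsSeparable ρ}, sloccPoints ρ) = octahedron ∧
    -- duality
    (∀ W ρ, IsPotentialWitness W → IsSeparable ρ → ∀ x ∈ sloccPoints W, ∀ y ∈ sloccPoints ρ,
      0 ≤ 1 + x ⬝ᵥ y) ∧
    octahedron = polar cube ∧ cube = polar octahedron ∧ tetrahedron = polar tetrahedron ∧
    tetrahedron = convexHull ℝ {![1, 1, -1], ![1, -1, 1], ![-1, 1, 1], ![-1, -1, -1]} := by
  have orbit_self : ∀ u : Fin 3 → ℝ, u ∈ MulAction.orbit tetrahedralGroup u :=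
    fun u => MulAction.mem_orbit_self u
  refine ⟨fun ρ h => h.isState, fun ρ h => h.isPotentialWitness, fun ρ ρ' h => h.isSeparable,
    fun ρ ρ' h => h.isState,
    fun W W' h => ((witnessEquiv_iff_stateEquiv W W').1 h).isPotentialWitness,
    ⟨stateEquiv_refl, StateEquiv.symm, StateEquiv.trans⟩, witnessEquiv_iff_stateEquiv,
    fun W h => ?_, fun W W' _ h => (((witnessEquiv_iff_stateEquiv W W').1 h).sloccPoints_eq).symm,
    card_tetrahedralGroup, image_tetrahedron, charpoly_canonicalForm,
    isPotentialWitness_normalForm_iff, isState_normalForm_iff, isSeparable_normalForm_iff,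
    fun u => sloccPoints_normalForm, fun u hu u' hu' => ⟨fun h => ?_, fun h => ?_⟩,
    fun W h => ?_, fun W W' hW hW' => ⟨fun h => ?_, fun h => ?_⟩, fun W hW => ?_, fun W hW => ?_,
    ?_, exists_inequivalent_of_sloccPoints_eq, ?_, ?_, ?_, fun W ρ hW hρ x hx y hy => ?_,
    octahedron_eq_polar_cube, cube_eq_polar_octahedron, tetrahedron_eq_polar,
    tetrahedron_eq_convexHull⟩
  · obtain ⟨s, hs⟩ := h.exists_isLorentzSingularValues
    exact ⟨s, hs, fun s' hs' => hs'.unique hs⟩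
  · rw [← sloccPoints_normalForm hu,
      ((witnessEquiv_iff_stateEquiv _ _).1 h).sloccPoints_eq, sloccPoints_normalForm hu']
    exact orbit_self u'
  · exact (witnessEquiv_iff_stateEquiv _ _).2 (stateEquiv_of_mem_orbit h)
  · obtain ⟨u, hu, hWu⟩ := h.exists_normalForm
    exact ⟨u, hu, (witnessEquiv_iff_stateEquiv _ _).2 hWu⟩
  · exact ((witnessEquiv_iff_stateEquiv W W').1 h).sloccPoints_eq
  · obtain ⟨u, -, hWu, hp⟩ := hW.sloccPoints_eq
    obtain ⟨u', -, hWu', hp'⟩ := hW'.sloccPoints_eq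
    -- Equal point sets are equal orbits, so the two normal forms are linked by a symmetry in G,
    -- which is a local operation.
    have hu' : u' ∈ MulAction.orbit tetrahedralGroup u := by
      rw [← hp, h, hp']
      exact orbit_self u'
    exact (witnessEquiv_iff_stateEquiv W W').2
      ((hWu.trans (stateEquiv_of_mem_orbit hu')).trans hWu'.symm)
  · refine ⟨IsState.sloccPoints_subset, fun h => ?_⟩
    obtain ⟨u, -, hWu, hp⟩ := hW.sloccPoints_eq
    rw [hp] at h
    exact hWu.symm.isState ((isState_normalForm_iff u).2 (h (orbit_self u)))
  · refine ⟨IsSeparable.sloccPoints_subset, fun h => ?_⟩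
    obtain ⟨u, -, hWu, hp⟩ := hW.sloccPoints_eq
    rw [hp] at h
    exact hWu.symm.isSeparable ((isSeparable_normalForm_iff u).2 (h (orbit_self u)))
  · refine Set.Subset.antisymm (Set.iUnion₂_subset fun W hW => ?_) fun u hu => ?_
    · obtain ⟨u, hu, -, hp⟩ := IsStrictWitness.sloccPoints_eq hW
      rw [hp]
      exact fun v hv => mem_openCube_of_mem_orbit hv hu
    · refine Set.mem_iUnion₂.2 ⟨normalForm u, isStrictWitness_normalForm hu, ?_⟩
      rw [sloccPoints_normalForm (openCube_subset_cube hu)]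
      exact orbit_self u
  · refine Set.Subset.antisymm (Set.iUnion₂_subset fun W _ => sloccPoints_subset_cube W)
      fun u hu => Set.mem_iUnion₂.2
        ⟨normalForm u, (isPotentialWitness_normalForm_iff u).2 hu, ?_⟩
    rw [sloccPoints_normalForm hu]
    exact orbit_self u
  · refine Set.Subset.antisymm (Set.iUnion₂_subset fun ρ hρ => IsState.sloccPoints_subset hρ)
      fun u hu => Set.mem_iUnion₂.2 ⟨normalForm u, (isState_normalForm_iff u).2 hu, ?_⟩
    rw [sloccPoints_normalForm (tetrahedron_subset_cube hu)]
    exact orbit_self u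
  · refine Set.Subset.antisymm (Set.iUnion₂_subset fun ρ hρ => IsSeparable.sloccPoints_subset hρ)
      fun u hu => Set.mem_iUnion₂.2 ⟨normalForm u, (isSeparable_normalForm_iff u).2 hu, ?_⟩
    rw [sloccPoints_normalForm (octahedron_subset_cube hu)]
    exact orbit_self u
  · exact octahedron_subset_polar_cube (hρ.sloccPoints_subset hy) x (sloccPoints_subset_cube W hx)
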